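/- **Setting.** Let $A\in\mathbb R^{n\times n}$, $B\in\mathbb R^{n\times m}$, $C\in\mathbb R^{p\times n}$, and let $K$, $L$ be such that $A+BK$ and $A-LC$ are Hurwitz. Let $D_1,D_2:\mathbb R\to(0,\infty)$ be continuous delays and $\phi_i(t)=t-D_i(t)$. Assume for $i=1,2$ that $\phi_i$ is $C^1$ on $(0,\infty)$; that there are constants $\pi_0^*,\pi_2^*>0$ with $t-\phi_i(t)\ge\pi_0^*$ and $\phi_i'(t)\ge\pi_2^*$ for all $t>0$; and that $\nu-\phi_i(\nu)$ and $\phi_i'(\nu)$ are bounded above on $\nu\ge\phi_i^{-1}(0)$. Let $\psi(t)=\phi_1^{-1}(t)-t$, $t\ge0$, be the exact prediction horizon. For a function $\hat\psi$ on $[0,\infty)$, a solution of the closed loop with horizon $\hat\psi$ is a triple $(Z,\xi,U)$ with $Z:[\phi_2(0),\infty)\to\mathbb R^n$ and $\xi:[0,\infty)\to\mathbb R^n$ continuous and $U$ an $\mathbb R^m$-valued, Borel measurable, locally bounded function of time, such that, in the integral sense, $$\dot Z(t)=AZ(t)+BU(\phi_1(t)),\qquad t\ge\phi_2(0),$$ $$\dot\xi(t)=\phi_2'(t)\bigl[A\xi(t)+BU(\phi_1(\phi_2(t)))+L\bigl(CZ(\phi_2(t))-C\xi(t)\bigr)\bigr],\qquad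 t\ge0,$$ and $U(t)=K\hat P(t)$ for $t>0$, where $$\hat Z(t)=e^{A(t-\phi_2(t))}\xi(t)+\int_{\phi_2(t)}^te^{A(t-\tau)}BU(\phi_1(\tau))\,d\tau,$$ $$\hat P(t)=e^{A\hat\psi(t)}\hat Z(t)+\int_0^1\hat\psi(t)\,e^{A(1-y)\hat\psi(t)}B\,u(y,t)\,dy,\qquad u(y,t)=U(\phi_1(t+y\psi(t)));$$ at times $t$ with $\hat\psi(t)\le\psi(t)$ the predictor may alternatively be $$\hat P(t)=e^{A\hat\psi(t)}\hat Z(t)+\int_t^{t+\hat\psi(t)}e^{A(t+\hat\psi(t)-s)}BU(\phi_1(s))\,ds.$$ (The two forms coincide for $\hat\psi=\psi$.) The values of $U$ up to time $0$, $Z(\phi_2(0))$ and $\xi(0)$ are free initial data. Put $$\Gamma(t)=|Z(t)|^2+|Z(t)-\hat Z(t)|^2+\sup_{\phi_1(t)\le\tau\le t}|U(\tau)|^2 .$$ **Constants.** Call $(\epsilon^*,M,C(\cdot))$ *stability constants* of the system if $\epsilon^*>0$, $M>0$, $C$ is a positive, decreasing (not necessarily strictly) function on $(0,\epsilon^*]$,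 and for every $\epsilon\in(0,\epsilon^*)$ and every $\hat\psi$ with $|\psi(t)-\hat\psi(t)|\le\epsilon$ for all $t\ge0$, all closed-loop solutions satisfy $\Gamma(t)\le Me^{-C(\epsilon)t}\,\Gamma(0)$ for all $t\ge0$. **Claim.** Stability constants exist, even with $C$ strictly decreasing. Moreover, for any stability constants $(\epsilon^*,M,C(\cdot))$, any $\epsilon\in(0,\epsilon^*)$ and any window length $H>0$ with $H>\ln(M)/C(\epsilon^*)$: 1. for every $t\ge0$ there is an approximation $\hat\psi_t$, continuous on $[t,t+H]$, with $|\psi(\tau)-\hat\psi_t(\tau)|\le\epsilon$ for $\tau\in[t,t+H]$; 2. $\bar C:=C(\epsilon)-\ln(M)/H>0$; 3. if the approximation is recomputed on the successive windows $[kH,(k+1)H]$, $k=0,1,2,\dots$, that is, the closed loop uses $\hat\psi(t)=\hat\psi_k(t)$ for $t\in[kH,(k+1)H)$, where $|\psi(\tau)-\hat\psi_k(\tau)|\le\epsilon$ for all $\tau\in[kH,(k+1)H]$ and every $k$, then all closed-loop solutions satisfy $$\Gamma(t)\le M e^{-\bar C t}\,\Gamma(0)\qquad\text{for all }t\ge0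 .$$ -/

import Mathlib

open Set MeasureTheory

noncomputable section

/-- `ℝᵈ` with the Euclidean norm. -/
abbrev Vec (d : ℕ) : Type := EuclideanSpace ℝ (Fin d)

/-- Matrix times vector, on Euclidean spaces. -/
abbrev mulE {a b : ℕ} (M : Matrix (Fin a) (Fin b) ℝ) (x : Vec b) : Vec a :=
  Matrix.toEuclideanLin M x

/-- A real square matrix is Hurwitz if all its complex eigenvalues have negative real part. -/
def IsHurwitz {d : ℕ} (M : Matrix (Fin d) (Fin d) ℝ) : Prop :=
  ∀ z ∈ spectrum ℂ (M.map (algebraMap ℝ ℂ)), z.re < 0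

/-- The data: plant matrices `A`, `B`, `C`, feedback and observer gains `K`, `L`, and the
input and measurement delays `D₁`, `D₂`. -/
structure DelaySystem (n m p : ℕ) where
  A : Matrix (Fin n) (Fin n) ℝ
  B : Matrix (Fin n) (Fin m) ℝ
  C : Matrix (Fin p) (Fin n) ℝ
  K : Matrix (Fin m) (Fin n) ℝ
  L : Matrix (Fin n) (Fin p) ℝ
  D₁ : ℝ → ℝ
  D₂ : ℝ → ℝ

/-- The delayed time `φ(t) = t - D(t)`. -/
def delayedTime (D : ℝ → ℝ) (t : ℝ) : ℝ := t - D t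

/-- The inverse `φ⁻¹` of `φ : [0, ∞) → ℝ`. -/
def delayedTimeInv (D : ℝ → ℝ) (y : ℝ) : ℝ :=
  Function.invFunOn (delayedTime D) (Ici 0) y

/-- The assumptions on one delay: `D` is positive and continuous, `φ(t) = t - D(t)` is `C¹` for
`t > 0`, `D ≥ π₀ > 0` and `φ' ≥ π₂ > 0` for `t > 0`, and the suprema of `D = ν - φ(ν)` and of
`φ'` over `ν ≥ φ⁻¹(0)` are finite (their reciprocals are positive numbers). -/
structure AdmissibleDelay (D : ℝ → ℝ) : Prop where
  pos : ∀ t, 0 < D t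
  cont : Continuous D
  contDiff : ContDiffOn ℝ 1 (delayedTime D) (Ioi 0)
  lower : ∃ π₀ > 0, ∀ t > 0, π₀ ≤ t - delayedTime D t
  bdd : BddAbove ((fun ν => ν - delayedTime D ν) '' Ici (delayedTimeInv D 0))
  deriv_lower : ∃ π₂ > 0, ∀ t > 0, π₂ ≤ deriv (delayedTime D) t
  deriv_bdd : BddAbove (deriv (delayedTime D) '' Ici (delayedTimeInv D 0))

/-- `φ⁻¹` really is the inverse of `φ` on `[φ(0), ∞)`, in particular on `[0, ∞)`. -/
theorem AdmissibleDelay.inv_spec {D : ℝ → ℝ} (h : AdmissibleDelay D) {y : ℝ}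
    (hy : delayedTime D 0 ≤ y) :
    0 ≤ delayedTimeInv D y ∧ delayedTime D (delayedTimeInv D y) = y := by
  obtain ⟨c, hc, hd⟩ := h.deriv_lower
  have hcont : Continuous (delayedTime D) := continuous_id.sub h.cont
  have hgrow : ∀ t, 0 ≤ t → c * (t - 0) ≤ delayedTime D t - delayedTime D 0 := by
    intro t ht
    refine (convex_Ici (0 : ℝ)).mul_sub_le_image_sub_of_le_deriv hcont.continuousOn ?_ ?_
      0 self_mem_Ici t ht ht
    · rw [interior_Ici]
      exact h.contDiff.differentiableOn (by norm_num)
    · rw [interior_Ici]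
      exact fun x hx => hd x hx
  set T := (y - delayedTime D 0) / c with hT
  have hT0 : 0 ≤ T := div_nonneg (by linarith) hc.le
  have h1 := hgrow T hT0
  have h2 : c * T = y - delayedTime D 0 := by rw [hT]; field_simp
  have hmem : ∃ a ∈ Ici (0 : ℝ), delayedTime D a = y := by
    obtain ⟨a, ha, hay⟩ := intermediate_value_Icc hT0 hcont.continuousOn
      (show y ∈ Icc (delayedTime D 0) (delayedTime D T) from ⟨hy, by linarith⟩)
    exact ⟨a, ha.1, hay⟩
  exact ⟨Function.invFunOn_mem hmem, Function.invFunOn_eq hmem⟩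

namespace DelaySystem

variable {n m p : ℕ} (S : DelaySystem n m p)

/-- Both delays are admissible, and `A + BK`, `A - LC` are Hurwitz. -/
structure Admissible : Prop where
  delay₁ : AdmissibleDelay S.D₁
  delay₂ : AdmissibleDelay S.D₂
  hurwitz_feedback : IsHurwitz (S.A + S.B * S.K)
  hurwitz_observer : IsHurwitz (S.A - S.L * S.C)

/-- `φ₁(t) = t - D₁(t)`. -/
def φ₁ (t : ℝ) : ℝ := delayedTime S.D₁ t

/-- `φ₂(t) = t - D₂(t)`. -/
def φ₂ (t : ℝ) : ℝ := delayedTime S.D₂ t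

/-- The exact prediction horizon `ψ(t) = φ₁⁻¹(t) - t`. -/
def ψ (t : ℝ) : ℝ := delayedTimeInv S.D₁ t - t

/-- The flow `e^{A r}` applied to a vector. -/
def flow (r : ℝ) (x : Vec n) : Vec n := mulE (NormedSpace.exp (r • S.A)) x

/-- The reconstructed current state
`Ẑ(t) = e^{A(t - φ₂(t))} ξ(t) + ∫_{φ₂(t)}^t e^{A(t-τ)} B U(φ₁(τ)) dτ`. -/
def zHat (ξ : ℝ → Vec n) (U : ℝ → Vec m) (t : ℝ) : Vec n :=
  S.flow (t - S.φ₂ t) (ξ t) +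
    ∫ τ in (S.φ₂ t)..t, S.flow (t - τ) (mulE S.B (U (S.φ₁ τ)))

/-- The predictor with horizon `h` at time `t`, in original time:
`e^{Ah} Ẑ(t) + ∫_t^{t+h} e^{A(t+h-s)} B U(φ₁(s)) ds`.
It uses only inputs up to time `t` if and only if `φ₁(t + h) ≤ t`, that is, `h ≤ ψ(t)`. -/
def predictorDirect (h : ℝ) (ξ : ℝ → Vec n) (U : ℝ → Vec m) (t : ℝ) : Vec n :=
  S.flow h (S.zHat ξ U t) +
    ∫ s in t..(t + h), S.flow (t + h - s) (mulE S.B (U (S.φ₁ s)))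

/-- The distributed input (state of the transport equation) `u(x,t) = U(φ₁(t + x ψ(t)))`,
`0 ≤ x ≤ 1`: the inputs on `[φ₁(t), t]` that have not yet reached the plant. -/
def distInput (U : ℝ → Vec m) (x t : ℝ) : Vec m := U (S.φ₁ (t + x * S.ψ t))

/-- The predictor with horizon `h` at time `t`, in terms of the distributed input:
`e^{Ah} Ẑ(t) + ∫_0^1 h e^{A(1-y)h} B u(y,t) dy`. It is causal for every `h`. -/
def predictorTransport (h : ℝ) (ξ : ℝ → Vec n) (U : ℝ → Vec m) (t : ℝ) : Vec n :=
  S.flow h (S.zHat ξ U t) +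
    ∫ y in (0 : ℝ)..1, h • S.flow ((1 - y) * h) (mulE S.B (S.distInput U y t))

/-- For the exact horizon `h = ψ(t)` the two forms of the predictor agree. -/
theorem predictorTransport_exact (ξ : ℝ → Vec n) (U : ℝ → Vec m) (t : ℝ) :
    S.predictorTransport (S.ψ t) ξ U t = S.predictorDirect (S.ψ t) ξ U t := by
  unfold predictorTransport predictorDirect distInput
  congr 1
  have key := intervalIntegral.smul_integral_comp_add_mul
    (f := fun s => S.flow (t + S.ψ t - s) (mulE S.B (U (S.φ₁ s)))) (a := 0) (b := 1) (S.ψ t) t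
  rw [intervalIntegral.integral_smul]
  simp only [mul_zero, add_zero, mul_one] at key
  rw [← key]
  congr 1
  refine intervalIntegral.integral_congr fun y _ => ?_
  rw [show t + S.ψ t - (t + S.ψ t * y) = (1 - y) * S.ψ t by ring, mul_comm y]

/-- `(Z, ξ, U)` is a solution of the closed loop in which the approximate horizon `ψh` is used.

`U` is Borel measurable and bounded on bounded intervals. The differential equations are
understood in integral (Carathéodory) form, since `U` may jump. The plant equation
`Ż = A Z + B U(φ₁)` holds from time `φ₂(0)` on, where the first measured state lies; `ξ(0)`, the
state `Z(φ₂(0))` and the inputs up to time `0` are free initial data. -/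
structure IsClosedLoop (ψh : ℝ → ℝ) (Z ξ : ℝ → Vec n) (U : ℝ → Vec m) : Prop where
  meas_U : Measurable U
  bdd_U : ∀ a b : ℝ, BddAbove ((fun τ => ‖U τ‖) '' Icc a b)
  cont_Z : ContinuousOn Z (Ici (S.φ₂ 0))
  cont_ξ : ContinuousOn ξ (Ici 0)
  plant : ∀ t ≥ S.φ₂ 0,
    Z t = Z (S.φ₂ 0) + ∫ s in (S.φ₂ 0)..t, (mulE S.A (Z s) + mulE S.B (U (S.φ₁ s)))
  observer : ∀ t ≥ 0,
    ξ t = ξ 0 + ∫ s in (0 : ℝ)..t, deriv S.φ₂ s •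
      (mulE S.A (ξ s) + mulE S.B (U (S.φ₁ (S.φ₂ s))) +
        mulE S.L (mulE S.C (Z (S.φ₂ s)) - mulE S.C (ξ s)))
  feedback : ∀ t > 0,
    U t = mulE S.K (S.predictorTransport (ψh t) ξ U t) ∨
      (ψh t ≤ S.ψ t ∧ U t = mulE S.K (S.predictorDirect (ψh t) ξ U t))

/-- `Γ(t) = |Z(t)|² + |Z(t) - Ẑ(t)|² + sup_{φ₁(t) ≤ τ ≤ t} |U(τ)|²`. -/
def Γ (Z ξ : ℝ → Vec n) (U : ℝ → Vec m) (t : ℝ) : ℝ :=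
  ‖Z t‖ ^ 2 + ‖Z t - S.zHat ξ U t‖ ^ 2 + sSup ((fun τ => ‖U τ‖ ^ 2) '' Icc (S.φ₁ t) t)

/-- `ε*`, `M` and the function `ε ↦ C(ε)` are robust stability constants of the system:
`C` is positive and decreasing on `(0, ε*]`, and `Γ(t) ≤ M e^{-C(ε)t} Γ(0)` along all solutions
of the closed loop with any approximation that is within `ε < ε*` of `ψ` for all time. -/
structure IsStabilityConstants (εs M : ℝ) (Cf : ℝ → ℝ) : Prop where
  eps_pos : 0 < εs
  M_pos : 0 < M
  rate_pos : ∀ ε ∈ Ioc 0 εs, 0 < Cf ε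
  rate_anti : AntitoneOn Cf (Ioc 0 εs)
  bound : ∀ ε ∈ Ioo 0 εs, ∀ ψh : ℝ → ℝ, (∀ t ≥ 0, |S.ψ t - ψh t| ≤ ε) →
    ∀ (Z ξ : ℝ → Vec n) (U : ℝ → Vec m), S.IsClosedLoop ψh Z ξ U →
      ∀ t ≥ 0, S.Γ Z ξ U t ≤ M * Real.exp (-Cf ε * t) * S.Γ Z ξ U 0

/-- The horizon used when the approximation is recomputed on the successive windows
`[kH, (k+1)H]`, the `k`-th approximation being `ψw k`. -/
def windowed (H : ℝ) (ψw : ℕ → ℝ → ℝ) (t : ℝ) : ℝ := ψw ⌊t / H⌋₊ t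

end DelaySystem

end

/-! The error of the observer, read in the time scale `φ₂`, obeys the undelayed equation of
`A - LC`, and so the reconstructed state `Ẑ` converges exponentially. With a horizon error `ε`, the
input therefore differs from the ideal feedback `K Z(φ₁⁻¹(t))` by an exponentially decaying term
plus at most `ε` times an exponential envelope of the whole trajectory. Since `A + BK` is Hurwitz,
an envelope of size `N` improves to one of size `c Γ(0)^{1/2} + c ε N`: for small `ε` this is a
contraction, and the envelope ends up proportional to the initial data, uniformly in time.

A horizon recomputed on successive windows is within `ε` of `ψ` for all time, so that the same
decay applies; the loss `log M / H` in the rate only weakens the bound if `M ≥ 1`, and for `M < 1`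
the bound at time `0` already forces `Γ(0) = 0`. -/

/-! ### Exponential flows -/

section ExpFlow

open NormedSpace

variable {𝔸 : Type*} [NormedRing 𝔸] [NormedAlgebra ℝ 𝔸] {a : 𝔸} {l c R : ℝ}

/-- The flow `exp (t a)` decays at least at the exponential rate `l` as `t → ∞`. -/
def HasExpDecay (a : 𝔸) (l : ℝ) : Prop :=
  ∃ c ≥ 0, ∀ t ≥ 0, ‖exp (t • a)‖ ≤ c * Real.exp (-l * t)

theorem HasExpDecay.mono {l' : ℝ} (h : HasExpDecay a l) (hl : l' ≤ l) : HasExpDecay a l' := by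
  obtain ⟨c, hc0, hc⟩ := h
  refine ⟨c, hc0, fun t ht => (hc t ht).trans ?_⟩
  gcongr

variable [CompleteSpace 𝔸]

theorem exp_add_smul_eq_mul (a : 𝔸) (r s : ℝ) :
    exp ((r + s) • a) = exp (r • a) * exp (s • a) := by
  let +nondep : NormedAlgebra ℚ 𝔸 := .restrictScalars ℚ ℝ 𝔸
  rw [add_smul]
  exact exp_add_of_commute (((Commute.refl a).smul_left r).smul_right s)

theorem exp_smul_mul_exp_neg_smul (a : 𝔸) (r : ℝ) : exp (r • a) * exp (-r • a) = 1 := by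
  rw [← exp_add_smul_eq_mul, add_neg_cancel, zero_smul, exp_zero]

theorem continuous_exp_smul (a : 𝔸) : Continuous fun r : ℝ => exp (r • a) :=
  continuous_iff_continuousAt.2 fun r => (hasDerivAt_exp_smul_const a r).continuousAt

theorem exists_norm_exp_smul_le (a : 𝔸) (R : ℝ) : ∃ c ≥ 0, ∀ r ∈ Icc 0 R, ‖exp (r • a)‖ ≤ c := by
  obtain ⟨c, hc⟩ := isCompact_Icc.exists_bound_of_continuousOn (continuous_exp_smul a).continuousOn
  exact ⟨max 0 c, le_max_left _ _, fun r hr => (hc r hr).trans (le_max_right _ _)⟩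

theorem norm_exp_smul_sub_le (hc : ∀ r ∈ Icc 0 R, ‖exp (r • a)‖ ≤ c) {r s : ℝ}
    (hr : r ∈ Icc 0 R) (hs : s ∈ Icc 0 R) :
    ‖exp (r • a) - exp (s • a)‖ ≤ c * ‖a‖ * |r - s| :=
  (convex_Icc 0 R).norm_image_sub_le_of_norm_hasDerivWithin_le
    (fun x _ => (hasDerivAt_exp_smul_const a x).hasDerivWithinAt)
    (fun x hx => norm_mul_le_of_le (hc x hx) le_rfl) hs hr

theorem norm_smul_exp_smul_sub_le (hc : ∀ r ∈ Icc 0 R, ‖exp (r • a)‖ ≤ c) {x r s : ℝ}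
    (hx : x ∈ Icc 0 1) (hr : r ∈ Icc 0 R) (hs : s ∈ Icc 0 R) :
    ‖r • exp ((x * r) • a) - s • exp ((x * s) • a)‖ ≤ c * (1 + R * ‖a‖) * |r - s| := by
  have hmem {y : ℝ} (hy : y ∈ Icc 0 R) : x * y ∈ Icc 0 R :=
    ⟨mul_nonneg hx.1 hy.1, (mul_le_of_le_one_left hy.1 hx.2).trans hy.2⟩
  have hc0 : 0 ≤ c := (norm_nonneg _).trans (hc r hr)
  have hR : 0 ≤ R := hr.1.trans hr.2
  have hdiff : ‖exp ((x * r) • a) - exp ((x * s) • a)‖ ≤ c * ‖a‖ * |r - s| := by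
    refine (norm_exp_smul_sub_le hc (hmem hr) (hmem hs)).trans ?_
    rw [← mul_sub, abs_mul, abs_of_nonneg hx.1]
    gcongr
    exact mul_le_of_le_one_left (abs_nonneg _) hx.2
  calc ‖r • exp ((x * r) • a) - s • exp ((x * s) • a)‖
      = ‖(r - s) • exp ((x * r) • a) + s • (exp ((x * r) • a) - exp ((x * s) • a))‖ := by
        rw [sub_smul, smul_sub, sub_add_sub_cancel]
    _ ≤ |r - s| * c + R * (c * ‖a‖ * |r - s|) := by
        refine norm_add_le_of_le ?_ ?_ <;> rw [norm_smul, Real.norm_eq_abs]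
        · gcongr
          exact hc _ (hmem hr)
        · rw [abs_of_nonneg hs.1]
          gcongr
          exact hs.2
    _ = c * (1 + R * ‖a‖) * |r - s| := by ring

theorem norm_exp_mul_add_smul_le {N : ℕ} (hc : ∀ r ∈ Icc (0 : ℝ) N, ‖exp (r • a)‖ ≤ c) {r : ℝ}
    (hr : r ∈ Icc (0 : ℝ) N) (k : ℕ) :
    ‖exp ((k * N + r) • a)‖ ≤ ‖exp a ^ N‖ ^ k * c := by
  let +nondep : NormedAlgebra ℚ 𝔸 := .restrictScalars ℚ ℝ 𝔸
  induction k with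
  | zero => simpa using hc r hr
  | succ k ih =>
    have hsplit : ((k + 1 : ℕ) * N + r : ℝ) = N + (k * N + r) := by push_cast; ring
    have hpow : exp ((N : ℝ) • a) = exp a ^ N := by rw [← exp_nsmul, Nat.cast_smul_eq_nsmul]
    rw [hsplit, exp_add_smul_eq_mul, hpow, pow_succ', mul_assoc]
    exact norm_mul_le_of_le le_rfl ih

theorem exists_hasExpDecay_of_norm_exp_pow_lt_one {N : ℕ} (hN : 0 < N) (h : ‖exp a ^ N‖ < 1) :
    ∃ l > 0, HasExpDecay a l := by
  have hN' : (0 : ℝ) < N := by exact_mod_cast hN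
  obtain ⟨c, hc0, hc⟩ := exists_norm_exp_smul_le a N
  obtain ⟨q, hq, hq1⟩ := exists_between (max_lt h one_pos)
  have hq0 : 0 < q := (le_max_right _ _).trans_lt hq
  have hlog : Real.log q < 0 := Real.log_neg hq0 hq1
  refine ⟨-Real.log q / N, div_pos (neg_pos.2 hlog) hN', c * Real.exp (-Real.log q), by positivity,
    fun t ht => ?_⟩
  set k := ⌊t / N⌋₊
  have hk : k * N ≤ t := (le_div_iff₀ hN').1 (Nat.floor_le (by positivity))
  have hk' : t < (k + 1) * N := (div_lt_iff₀ hN').1 (Nat.lt_floor_add_one _)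
  have hrem : t - k * N ∈ Icc (0 : ℝ) N := ⟨by linarith, by linarith⟩
  calc ‖exp (t • a)‖ = ‖exp ((k * N + (t - k * N)) • a)‖ := by rw [add_sub_cancel]
    _ ≤ ‖exp a ^ N‖ ^ k * c := norm_exp_mul_add_smul_le hc hrem k
    _ ≤ q ^ k * c := by gcongr; exact (le_max_left _ _).trans hq.le
    _ = c * Real.exp (k * Real.log q) := by rw [Real.exp_nat_mul, Real.exp_log hq0, mul_comm]
    _ ≤ c * Real.exp (-Real.log q + Real.log q * (t / N)) := by
      gcongr
      nlinarith [(div_lt_iff₀ hN').2 hk']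
    _ = c * Real.exp (-Real.log q) * Real.exp (-(-Real.log q / N) * t) := by
      rw [mul_assoc, ← Real.exp_add]
      ring_nf

end ExpFlow

theorem exists_norm_pow_lt_one_of_spectrum {𝔸 : Type*} [NormedRing 𝔸] [NormedAlgebra ℂ 𝔸]
    [CompleteSpace 𝔸] {x : 𝔸} (h : ∀ z ∈ spectrum ℂ x, ‖z‖ < 1) :
    ∃ N : ℕ, 0 < N ∧ ‖x ^ N‖ < 1 := by
  rcases subsingleton_or_nontrivial 𝔸 with _ | _
  · exact ⟨1, one_pos, by simp [Subsingleton.elim (x ^ 1) 0]⟩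
  have hradius : spectralRadius ℂ x < (1 : NNReal) :=
    spectrum.spectralRadius_lt_of_forall_lt _ fun z hz => by
      rw [← NNReal.coe_lt_coe]; exact h z hz
  obtain ⟨N, hN, hN0⟩ := (((spectrum.pow_nnnorm_pow_one_div_tendsto_nhds_spectralRadius
    x).eventually_lt_const hradius).and (Filter.eventually_gt_atTop 0)).exists
  refine ⟨N, hN0, ?_⟩
  by_contra! hge
  refine hN.not_ge ?_
  rw [ENNReal.coe_one]
  exact ENNReal.one_le_rpow (by exact_mod_cast hge) (by positivity)

/-! ### Hurwitz matrices -/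

section Hurwitz

open NormedSpace
open scoped Matrix.Norms.L2Operator Matrix

/-- `mulE` as a continuous linear map in the vector. -/
noncomputable def mulCLM {a b : ℕ} (M : Matrix (Fin a) (Fin b) ℝ) : Vec b →L[ℝ] Vec a :=
  LinearMap.toContinuousLinearMap (Matrix.toEuclideanLin M)

theorem mulE_eq_mulCLM {a b : ℕ} (M : Matrix (Fin a) (Fin b) ℝ) (x : Vec b) :
    mulE M x = mulCLM M x :=
  rfl

theorem mulCLM_mul_apply {a b d : ℕ} (M : Matrix (Fin a) (Fin b) ℝ) (N : Matrix (Fin b) (Fin d) ℝ)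
    (x : Vec d) : mulCLM (M * N) x = mulCLM M (mulCLM N x) := by
  ext i
  simp [mulCLM, Matrix.toEuclideanLin, Matrix.mulVec_mulVec]

variable {d : ℕ}

theorem mulCLM_exp_smul (M : Matrix (Fin d) (Fin d) ℝ) (r : ℝ) :
    mulCLM (exp (r • M)) = exp (r • mulCLM M) := by
  let +nondep : NormedAlgebra ℚ (Matrix (Fin d) (Fin d) ℝ) := .restrictScalars ℚ ℝ _
  change Matrix.toEuclideanCLM (𝕜 := ℝ) (exp (r • M)) = exp (r • Matrix.toEuclideanCLM (𝕜 := ℝ) M)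
  rw [map_exp (Matrix.toEuclideanCLM (n := Fin d) (𝕜 := ℝ))
    (AddMonoidHomClass.isometry_of_norm _ Matrix.l2_opNorm_toEuclideanCLM).continuous, map_smul]

theorem mulCLM_exp_pow (M : Matrix (Fin d) (Fin d) ℝ) (N : ℕ) :
    mulCLM (exp M ^ N) = exp (mulCLM M) ^ N := by
  have hexp := mulCLM_exp_smul M 1
  rw [one_smul, one_smul] at hexp
  rw [← hexp]
  exact map_pow (Matrix.toEuclideanCLM (n := Fin d) (𝕜 := ℝ)) _ _

theorem norm_mulCLM_le_norm_map_ofReal (Q : Matrix (Fin d) (Fin d) ℝ) :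
    ‖mulCLM Q‖ ≤ ‖Q.map (algebraMap ℝ ℂ)‖ := by
  refine ContinuousLinearMap.opNorm_le_bound _ (norm_nonneg _) fun x => ?_
  have hcomplex := Matrix.l2_opNorm_mulVec (Q.map (algebraMap ℝ ℂ))
    (WithLp.toLp 2 fun i => (x i : ℂ))
  have hmulVec (i : Fin d) :
      (Q.map Complex.ofReal *ᵥ fun j => (x j : ℂ)) i = (mulCLM Q x i : ℂ) := by
    simp [mulCLM, Matrix.toEuclideanLin, Matrix.mulVec, dotProduct]
  simpa [hmulVec, EuclideanSpace.norm_eq] using hcomplex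

theorem map_ofReal_exp (M : Matrix (Fin d) (Fin d) ℝ) :
    (exp M).map (algebraMap ℝ ℂ) = exp (M.map (algebraMap ℝ ℂ)) := by
  let +nondep : NormedAlgebra ℚ (Matrix (Fin d) (Fin d) ℝ) := .restrictScalars ℚ ℝ _
  exact map_exp (algebraMap ℝ ℂ).mapMatrix
    (Continuous.matrix_map continuous_id Complex.continuous_ofReal) M

theorem exp_mulVec_of_mulVec_eq_smul {M : Matrix (Fin d) (Fin d) ℂ} {v : Fin d → ℂ} {w : ℂ}
    (h : M *ᵥ v = w • v) : exp M *ᵥ v = Complex.exp w • v := by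
  have hpow (k : ℕ) : M ^ k *ᵥ v = w ^ k • v := by
    induction k with
    | zero => simp
    | succ k ih => rw [pow_succ, ← Matrix.mulVec_mulVec, h, Matrix.mulVec_smul, ih, smul_smul,
        pow_succ']
  have hseries := (exp_series_hasSum_exp' (𝕂 := ℂ) M).map (AddMonoidHom.mk' (· *ᵥ v)
    fun _ _ => Matrix.add_mulVec _ _ _) (continuous_id.matrix_mulVec continuous_const)
  have hscalar := (exp_series_hasSum_exp' (𝕂 := ℂ) w).smul_const v
  rw [Complex.exp_eq_exp_ℂ]
  refine hseries.unique (hscalar.congr_fun fun k => ?_)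
  simp [Matrix.smul_mulVec, hpow, smul_smul]

/-- The eigenspace of `exp M` for `z` is invariant under `M`, so it contains an eigenvector
of `M`. -/
theorem spectrum_exp_subset (M : Matrix (Fin d) (Fin d) ℂ) :
    spectrum ℂ (exp M) ⊆ Complex.exp '' spectrum ℂ M := by
  intro z hz
  have hcomm : Commute (exp M).toLin' M.toLin' :=
    (Commute.refl M).exp_left.map Matrix.toLinAlgEquiv'
  rw [← Matrix.spectrum_toLin', ← Module.End.hasEigenvalue_iff_mem_spectrum] at hz
  have : Nontrivial (Module.End.eigenspace (exp M).toLin' z) :=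
    Submodule.nontrivial_iff_ne_bot.2 hz
  obtain ⟨w, hw⟩ := Module.End.exists_eigenvalue
    (M.toLin'.restrict (Module.End.mapsTo_genEigenspace_of_comm hcomm z 1))
  obtain ⟨⟨v, hv⟩, hvw⟩ := hw.exists_hasEigenvector
  have hv0 : v ≠ 0 := fun h => hvw.2 (Subtype.ext h)
  have hMv : M *ᵥ v = w • v := congrArg Subtype.val hvw.apply_eq_smul
  have hEv : exp M *ᵥ v = z • v := Module.End.mem_eigenspace_iff.1 hv
  refine ⟨w, ?_, smul_left_injective ℂ hv0 ((exp_mulVec_of_mulVec_eq_smul hMv).symm.trans hEv)⟩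
  rw [← Matrix.spectrum_toLin', ← Module.End.hasEigenvalue_iff_mem_spectrum]
  exact Module.End.hasEigenvalue_of_hasEigenvector
    (Module.End.hasEigenvector_iff.2 ⟨Module.End.mem_eigenspace_iff.2 hMv, hv0⟩)

theorem IsHurwitz.exists_hasExpDecay {M : Matrix (Fin d) (Fin d) ℝ} (h : IsHurwitz M) :
    ∃ l > 0, HasExpDecay (mulCLM M) l := by
  have hspec : ∀ z ∈ spectrum ℂ (exp (M.map (algebraMap ℝ ℂ))), ‖z‖ < 1 := by
    intro z hz
    obtain ⟨w, hw, rfl⟩ := spectrum_exp_subset _ hz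
    rw [Complex.norm_exp, Real.exp_lt_one_iff]
    exact h w hw
  obtain ⟨N, hN, hlt⟩ := exists_norm_pow_lt_one_of_spectrum hspec
  refine exists_hasExpDecay_of_norm_exp_pow_lt_one hN (lt_of_le_of_lt ?_ hlt)
  rw [← mulCLM_exp_pow, ← map_ofReal_exp, ← Matrix.map_pow]
  exact norm_mulCLM_le_norm_map_ofReal _

end Hurwitz

/-! ### Variation of constants -/

section VariationOfConstants

open NormedSpace

variable {E F : Type*} [NormedAddCommGroup E] [NormedSpace ℝ E] [NormedAddCommGroup F]
  [NormedSpace ℝ F] {a b : ℝ}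

theorem intervalIntegrable_clm_apply {Φ : ℝ → E →L[ℝ] F} (hΦ : ContinuousOn Φ (uIcc a b))
    {g : ℝ → E} (hg : IntervalIntegrable g volume a b) :
    IntervalIntegrable (fun s => Φ s (g s)) volume a b := by
  rw [intervalIntegrable_iff] at hg ⊢
  obtain ⟨c, hc⟩ := isCompact_uIcc.exists_bound_of_continuousOn hΦ
  refine (hg.norm.const_mul c).mono' ?_ ?_
  · exact (ContinuousLinearMap.id ℝ (E →L[ℝ] F)).aestronglyMeasurable_comp₂
      ((hΦ.mono uIoc_subset_uIcc).aestronglyMeasurable measurableSet_uIoc) hg.aestronglyMeasurable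
  · exact (ae_restrict_iff' measurableSet_uIoc).2 (.of_forall fun s hs =>
      (Φ s).le_of_opNorm_le (hc s (uIoc_subset_uIcc hs)) _)

theorem absolutelyContinuousOnInterval_of_eq_integral {h Z : ℝ → E}
    (hh : IntervalIntegrable h volume a b)
    (heq : ∀ t ∈ uIcc a b, Z t = Z a + ∫ s in a..t, h s) :
    AbsolutelyContinuousOnInterval Z a b := by
  have hnorm := hh.norm.absolutelyContinuousOnInterval_intervalIntegral left_mem_uIcc
  refine squeeze_zero' (.of_forall fun I => Finset.sum_nonneg fun _ _ => dist_nonneg) ?_ hnorm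
  rw [Filter.eventually_inf_principal]
  refine .of_forall fun I hI => Finset.sum_le_sum fun i hi => ?_
  have hsub : ∀ z ∈ uIcc a b, IntervalIntegrable h volume a z := fun z hz =>
    hh.mono_set (uIcc_subset_uIcc_left hz)
  obtain ⟨hx, hy⟩ := hI.1 i hi
  rw [heq _ hx, heq _ hy, dist_add_left, dist_eq_norm, dist_eq_norm, Real.norm_eq_abs,
    intervalIntegral.integral_interval_sub_left (hsub _ hx) (hsub _ hy),
    intervalIntegral.integral_interval_sub_left (hsub _ hx).norm (hsub _ hy).norm]
  exact intervalIntegral.norm_integral_le_abs_integral_norm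

theorem absolutelyContinuousOnInterval_clm_apply {Φ : ℝ → E →L[ℝ] F} {Z : ℝ → E}
    (hΦ : AbsolutelyContinuousOnInterval Φ a b) (hZ : AbsolutelyContinuousOnInterval Z a b) :
    AbsolutelyContinuousOnInterval (fun t => Φ t (Z t)) a b := by
  obtain ⟨cΦ, hcΦ⟩ := hΦ.exists_bound
  obtain ⟨cZ, hcZ⟩ := hZ.exists_bound
  unfold AbsolutelyContinuousOnInterval at hΦ hZ
  refine squeeze_zero' (.of_forall fun I => Finset.sum_nonneg fun _ _ => dist_nonneg) ?_
    (by simpa using (hZ.const_mul cΦ).add (hΦ.mul_const cZ))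
  rw [Filter.eventually_inf_principal]
  refine .of_forall fun I hI => ?_
  rw [Finset.mul_sum, Finset.sum_mul, ← Finset.sum_add_distrib]
  refine Finset.sum_le_sum fun i hi => ?_
  obtain ⟨hx, hy⟩ := hI.1 i hi
  simp only [dist_eq_norm]
  calc ‖Φ (I.2 i).1 (Z (I.2 i).1) - Φ (I.2 i).2 (Z (I.2 i).2)‖
      = ‖Φ (I.2 i).1 (Z (I.2 i).1 - Z (I.2 i).2) + (Φ (I.2 i).1 - Φ (I.2 i).2) (Z (I.2 i).2)‖ := by
        simp
    _ ≤ _ := norm_add_le_of_le (ContinuousLinearMap.le_of_opNorm_le _ (hcΦ _ hx) _)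
        (ContinuousLinearMap.le_opNorm_of_le _ (hcZ _ hy))

variable {T : E →L[ℝ] E} {g Z : ℝ → E}

theorem ae_hasDerivAt_of_eq_integral {h : ℝ → E} [CompleteSpace E]
    (hh : IntervalIntegrable h volume a b) (heq : ∀ t ∈ uIcc a b, Z t = Z a + ∫ s in a..t, h s) :
    ∀ᵐ t, t ∈ uIcc a b → HasDerivAt Z (h t) t := by
  filter_upwards [hh.ae_hasDerivAt_integral, Measure.ae_ne volume (min a b),
    Measure.ae_ne volume (max a b)] with t hderiv htmin htmax ht
  have hnhds : uIcc a b ∈ nhds t := Icc_mem_nhds (ht.1.lt_of_ne' htmin) (ht.2.lt_of_ne htmax)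
  exact ((hderiv ht a left_mem_uIcc).const_add (Z a)).congr_of_eventuallyEq
    (Filter.eventually_of_mem hnhds heq)

/-- The function `t ↦ e^{(b-t)T} Z(t) - ∫_a^t e^{(b-s)T} g(s) ds` is absolutely continuous with
derivative zero almost everywhere, hence constant. -/
theorem eq_exp_smul_add_integral_of_eq_integral [CompleteSpace E] (hZ : ContinuousOn Z (uIcc a b))
    (hg : IntervalIntegrable g volume a b)
    (heq : ∀ t ∈ uIcc a b, Z t = Z a + ∫ s in a..t, (T (Z s) + g s)) :
    Z b = exp ((b - a) • T) (Z a) + ∫ s in a..b, exp ((b - s) • T) (g s) := by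
  set Φ : ℝ → E →L[ℝ] E := fun s => exp ((b - s) • T) with hΦ
  have hΦderiv (s : ℝ) : HasDerivAt Φ (-(Φ s * T)) s :=
    ((hasDerivAt_exp_smul_const T (b - s)).scomp s
      ((hasDerivAt_id s).const_sub b)).congr_deriv (by simp [Φ])
  have hΦcont : Continuous Φ := continuous_iff_continuousAt.2 fun s => (hΦderiv s).continuousAt
  have hΦdiff : ContDiff ℝ 1 Φ := contDiff_one_iff_deriv.2
    ⟨fun s => (hΦderiv s).differentiableAt,
      deriv_eq hΦderiv ▸ (hΦcont.mul continuous_const).neg⟩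
  have hh : IntervalIntegrable (fun s => T (Z s) + g s) volume a b :=
    (T.continuous.comp_continuousOn hZ).intervalIntegrable.add hg
  have hk : IntervalIntegrable (fun s => Φ s (g s)) volume a b :=
    intervalIntegrable_clm_apply hΦcont.continuousOn hg
  set f : ℝ → E := (fun s => Φ s (Z s)) - fun s => ∫ r in a..s, Φ r (g r) with hf
  have hac : AbsolutelyContinuousOnInterval f a b :=
    (absolutelyContinuousOnInterval_clm_apply hΦdiff.contDiffOn.absolutelyContinuousOnInterval
      (absolutelyContinuousOnInterval_of_eq_integral hh heq)).sub
      (absolutelyContinuousOnInterval_of_eq_integral hk fun s _ => by simp)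
  have hderiv : ∀ᵐ s, s ∈ uIcc a b → HasDerivAt f 0 s := by
    filter_upwards [ae_hasDerivAt_of_eq_integral hh heq, hk.ae_hasDerivAt_integral]
      with s hZs hks hs
    convert ((hΦderiv s).clm_apply (hZs hs)).sub (hks hs a left_mem_uIcc) using 1
    simp
  obtain ⟨C, hC⟩ := hac.const_of_ae_hasDerivAt_zero hderiv
  have hends := (hC b right_mem_uIcc).trans (hC a left_mem_uIcc).symm
  simp only [hf, hΦ, Pi.sub_apply, intervalIntegral.integral_same, sub_zero, sub_self, zero_smul,
    exp_zero, one_apply_eq_self] at hends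
  exact sub_eq_iff_eq_add.1 hends

theorem integral_exp_neg_mul_sub_le {κ : ℝ} (hκ : 0 < κ) (a b : ℝ) :
    ∫ s in a..b, Real.exp (-κ * (b - s)) ≤ 1 / κ := by
  have hderiv : ∀ s ∈ uIcc a b,
      HasDerivAt (fun s => Real.exp (-κ * (b - s)) / κ) (Real.exp (-κ * (b - s))) s := by
    intro s _
    refine ((((hasDerivAt_id s).const_sub b).const_mul (-κ)).exp.div_const κ).congr_deriv ?_
    simp [field]
  rw [intervalIntegral.integral_eq_sub_of_hasDerivAt hderiv
    (Continuous.intervalIntegrable (by fun_prop) _ _)]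
  simp only [sub_self, mul_zero, Real.exp_zero, sub_le_self_iff]
  positivity

theorem norm_le_exp_of_eq_integral [CompleteSpace E] {c δ l μ : ℝ} (hc : 0 ≤ c)
    (hT : ∀ t ≥ 0, ‖exp (t • T)‖ ≤ c * Real.exp (-l * t)) (hμ : μ < l) (hab : a ≤ b)
    (hZ : ContinuousOn Z (Icc a b)) (hg : IntervalIntegrable g volume a b)
    (hδ : 0 ≤ δ) (hgδ : ∀ s ∈ Ioc a b, ‖g s‖ ≤ δ * Real.exp (-μ * s))
    (heq : ∀ t ∈ Icc a b, Z t = Z a + ∫ s in a..t, (T (Z s) + g s)) :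
    ‖Z b‖ ≤ c * (‖Z a‖ * Real.exp (μ * a) + δ / (l - μ)) * Real.exp (-μ * b) := by
  have hfree : ‖exp ((b - a) • T) (Z a)‖ ≤
      c * (‖Z a‖ * Real.exp (μ * a)) * Real.exp (-μ * b) := by
    refine (ContinuousLinearMap.le_of_opNorm_le _ (hT _ (sub_nonneg.2 hab)) _).trans ?_
    calc c * Real.exp (-l * (b - a)) * ‖Z a‖ ≤ c * Real.exp (-μ * (b - a)) * ‖Z a‖ := by
          gcongr
      _ = c * (‖Z a‖ * Real.exp (μ * a)) * Real.exp (-μ * b) := by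
          rw [show -μ * (b - a) = μ * a + -μ * b by ring, Real.exp_add]
          ring
  have hforced : ‖∫ s in a..b, exp ((b - s) • T) (g s)‖ ≤
      c * (δ / (l - μ)) * Real.exp (-μ * b) := by
    have hpointwise : ∀ s ∈ Ioc a b, ‖exp ((b - s) • T) (g s)‖ ≤
        c * δ * Real.exp (-μ * b) * Real.exp (-(l - μ) * (b - s)) := by
      intro s hs
      refine (ContinuousLinearMap.le_of_opNorm_le_of_le _ (hT _ (sub_nonneg.2 hs.2))
        (hgδ s hs)).trans_eq ?_
      rw [mul_mul_mul_comm, ← Real.exp_add, mul_assoc _ (Real.exp _), ← Real.exp_add]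
      ring_nf
    refine (intervalIntegral.norm_integral_le_of_norm_le hab (.of_forall hpointwise)
      (Continuous.intervalIntegrable (by fun_prop) _ _)).trans ?_
    rw [intervalIntegral.integral_const_mul]
    refine (mul_le_mul_of_nonneg_left (integral_exp_neg_mul_sub_le (sub_pos.2 hμ) a b)
      (by positivity)).trans_eq (by ring)
  rw [← uIcc_of_le hab] at hZ heq
  rw [eq_exp_smul_add_integral_of_eq_integral hZ hg heq, mul_add, add_mul]
  exact norm_add_le_of_le hfree hforced

end VariationOfConstants

/-! ### Delayed time -/

section Delay

variable {D : ℝ → ℝ}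

/-- A bounded delay `D ≥ 0` whose delayed time `φ(t) = t - D(t)` is an increasing time change of
`[0, ∞)`; no smoothness of `φ` is required. -/
structure MonotoneDelay (D : ℝ → ℝ) : Prop where
  continuous : Continuous D
  nonneg : ∀ t ≥ 0, 0 ≤ D t
  bddAbove : BddAbove (D '' Ici 0)
  strictMonoOn : StrictMonoOn (delayedTime D) (Ici 0)

theorem AdmissibleDelay.exists_forall_le (h : AdmissibleDelay D) : ∃ r > 0, ∀ t ≥ 0, r ≤ D t := by
  obtain ⟨r, hr, hl⟩ := h.lower
  refine ⟨min r (D 0), lt_min hr (h.pos 0), fun t ht => ?_⟩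
  rcases ht.eq_or_lt with rfl | ht
  · exact min_le_right _ _
  · exact (min_le_left _ _).trans (by simpa [delayedTime] using hl t ht)

theorem AdmissibleDelay.bddAbove_image_Ici (h : AdmissibleDelay D) : BddAbove (D '' Ici 0) := by
  have hcover : Ici 0 ⊆ Icc 0 (delayedTimeInv D 0) ∪ Ici (delayedTimeInv D 0) := fun t ht =>
    (le_total t (delayedTimeInv D 0)).imp (fun hle => ⟨ht, hle⟩) id
  refine BddAbove.mono (image_mono hcover) ?_
  rw [image_union]
  exact (isCompact_Icc.bddAbove_image h.cont.continuousOn).union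
    (by simpa [delayedTime] using h.bdd)

theorem AdmissibleDelay.monotoneDelay (h : AdmissibleDelay D) : MonotoneDelay D where
  continuous := h.cont
  nonneg t _ := (h.pos t).le
  bddAbove := h.bddAbove_image_Ici
  strictMonoOn := by
    obtain ⟨c, hc, hd⟩ := h.deriv_lower
    refine strictMonoOn_of_deriv_pos (convex_Ici 0) (continuous_id.sub h.cont).continuousOn ?_
    exact fun t ht => hc.trans_le (hd t (interior_Ici.subset ht))

namespace MonotoneDelay

theorem continuous_delayedTime (h : MonotoneDelay D) : Continuous (delayedTime D) :=
  continuous_id.sub h.continuous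

theorem exists_forall_le (h : MonotoneDelay D) : ∃ R ≥ 0, ∀ t ≥ 0, D t ≤ R := by
  obtain ⟨R, hR⟩ := h.bddAbove
  have hle : ∀ t ≥ 0, D t ≤ R := fun t ht => hR (mem_image_of_mem D ht)
  exact ⟨R, (h.nonneg 0 le_rfl).trans (hle 0 le_rfl), hle⟩

theorem delayedTime_le (h : MonotoneDelay D) {t : ℝ} (ht : 0 ≤ t) : delayedTime D t ≤ t :=
  sub_le_self t (h.nonneg t ht)

theorem monotoneOn (h : MonotoneDelay D) : MonotoneOn (delayedTime D) (Ici 0) :=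
  h.strictMonoOn.monotoneOn

theorem surjOn (h : MonotoneDelay D) :
    SurjOn (delayedTime D) (Ici 0) (Ici (delayedTime D 0)) := by
  intro y hy
  obtain ⟨R, -, hR⟩ := h.exists_forall_le
  have hyR : 0 ≤ y + R := by
    have h0 := hR 0 le_rfl
    simp only [delayedTime, mem_Ici] at hy
    linarith
  obtain ⟨t, ht, hty⟩ := intermediate_value_Icc hyR h.continuous_delayedTime.continuousOn
    (show y ∈ Icc _ (delayedTime D (y + R)) from
      ⟨hy, le_sub_iff_add_le.2 (by linarith [hR _ hyR])⟩)
  exact ⟨t, ht.1, hty⟩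

variable {x y t : ℝ}

theorem delayedTimeInv_nonneg (h : MonotoneDelay D) (hy : delayedTime D 0 ≤ y) :
    0 ≤ delayedTimeInv D y :=
  h.surjOn.mapsTo_invFunOn hy

theorem delayedTime_delayedTimeInv (h : MonotoneDelay D) (hy : delayedTime D 0 ≤ y) :
    delayedTime D (delayedTimeInv D y) = y :=
  h.surjOn.rightInvOn_invFunOn hy

theorem delayedTimeInv_delayedTime (h : MonotoneDelay D) (ht : 0 ≤ t) :
    delayedTimeInv D (delayedTime D t) = t :=
  h.strictMonoOn.injOn.leftInvOn_invFunOn ht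

theorem delayedTimeInv_le_iff (h : MonotoneDelay D) (hy : delayedTime D 0 ≤ y) (ht : 0 ≤ t) :
    delayedTimeInv D y ≤ t ↔ y ≤ delayedTime D t := by
  rw [← h.strictMonoOn.le_iff_le (h.delayedTimeInv_nonneg hy) ht,
    h.delayedTime_delayedTimeInv hy]

theorem monotoneOn_delayedTimeInv (h : MonotoneDelay D) :
    MonotoneOn (delayedTimeInv D) (Ici (delayedTime D 0)) := fun x hx y hy hxy => by
  rwa [h.delayedTimeInv_le_iff hx (h.delayedTimeInv_nonneg hy), h.delayedTime_delayedTimeInv hy]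

theorem continuousOn_delayedTimeInv (h : MonotoneDelay D) :
    ContinuousOn (delayedTimeInv D) (Ici (delayedTime D 0)) := by
  have hmaps : MapsTo (delayedTimeInv D) (Ici (delayedTime D 0)) (Ici 0) :=
    fun _ => h.delayedTimeInv_nonneg
  refine continuousOn_iff_continuous_domRestrict.2
    (continuous_subtype_val.comp (Monotone.continuous_of_surjective (f := hmaps.restrict) ?_ ?_))
  · exact fun x y hxy => h.monotoneOn_delayedTimeInv x.2 y.2 hxy
  · rintro ⟨t, ht⟩
    exact ⟨⟨delayedTime D t, h.monotoneOn self_mem_Ici ht ht⟩,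
      Subtype.ext (h.delayedTimeInv_delayedTime ht)⟩

theorem integral_deriv_smul_comp {E : Type*} [NormedAddCommGroup E] [NormedSpace ℝ E]
    (h : MonotoneDelay D) (hd : DifferentiableOn ℝ (delayedTime D) (Ioi 0)) (g : ℝ → E)
    (ht : 0 ≤ t) :
    ∫ s in 0..t, deriv (delayedTime D) s • g (delayedTime D s) =
      ∫ r in (delayedTime D 0)..(delayedTime D t), g r := by
  have hpos : ∀ s ∈ Ioo (min 0 t) (max 0 t), s ∈ Ioi 0 := fun s hs => by
    simpa [ht] using hs.1
  refine intervalIntegral.integral_deriv_smul_comp_of_deriv_nonneg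
    h.continuous_delayedTime.continuousOn
    (fun s hs => (hd.differentiableAt (Ioi_mem_nhds (hpos s hs))).hasDerivAt) fun s hs => ?_
  rw [← derivWithin_of_mem_nhds (Ioi_mem_nhds (hpos s hs))]
  exact (h.monotoneOn.mono Ioi_subset_Ici_self).derivWithin_nonneg

end MonotoneDelay

end Delay

namespace DelaySystem

variable {n m p : ℕ} {S : DelaySystem n m p}

/-- The conditions on the delays under which the predictor feedback is stabilizing: both delayed
times are increasing time changes, the input delay is bounded away from zero, and the observer,
which involves `φ₂'`, is driven by a differentiable `φ₂`. -/
structure RegularDelays (S : DelaySystem n m p) : Prop where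
  delay₁ : MonotoneDelay S.D₁
  lower₁ : ∃ r > 0, ∀ t ≥ 0, r ≤ S.D₁ t
  delay₂ : MonotoneDelay S.D₂
  differentiableOn_φ₂ : DifferentiableOn ℝ S.φ₂ (Ioi 0)

theorem Admissible.regularDelays (hS : S.Admissible) : S.RegularDelays where
  delay₁ := hS.delay₁.monotoneDelay
  lower₁ := hS.delay₁.exists_forall_le
  delay₂ := hS.delay₂.monotoneDelay
  differentiableOn_φ₂ := hS.delay₂.contDiff.differentiableOn one_ne_zero

/-- The time `φ₁⁻¹(t) = t + ψ(t)` at which the input issued at time `t` reaches the plant. -/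
noncomputable def arrival (S : DelaySystem n m p) (t : ℝ) : ℝ := delayedTimeInv S.D₁ t

theorem add_ψ (S : DelaySystem n m p) (t : ℝ) : t + S.ψ t = S.arrival t :=
  add_sub_cancel t _

namespace RegularDelays

variable {s t : ℝ}

theorem continuous_φ₁ (hD : S.RegularDelays) : Continuous S.φ₁ := hD.delay₁.continuous_delayedTime

theorem φ₁_le (hD : S.RegularDelays) (ht : 0 ≤ t) : S.φ₁ t ≤ t := hD.delay₁.delayedTime_le ht

theorem φ₁_zero_le (hD : S.RegularDelays) (ht : 0 ≤ t) : S.φ₁ 0 ≤ t := (hD.φ₁_le le_rfl).trans ht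

theorem φ₂_le (hD : S.RegularDelays) (ht : 0 ≤ t) : S.φ₂ t ≤ t := hD.delay₂.delayedTime_le ht

theorem φ₂_zero_le (hD : S.RegularDelays) (ht : 0 ≤ t) : S.φ₂ 0 ≤ t := (hD.φ₂_le le_rfl).trans ht

theorem φ₁_arrival (hD : S.RegularDelays) (ht : 0 ≤ t) : S.φ₁ (S.arrival t) = t :=
  hD.delay₁.delayedTime_delayedTimeInv (hD.φ₁_zero_le ht)

theorem arrival_φ₁ (hD : S.RegularDelays) (ht : 0 ≤ t) : S.arrival (S.φ₁ t) = t :=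
  hD.delay₁.delayedTimeInv_delayedTime ht

theorem ψ_eq (hD : S.RegularDelays) (ht : 0 ≤ t) : S.ψ t = S.D₁ (S.arrival t) := by
  have harr : S.arrival t - S.D₁ (S.arrival t) = t := hD.φ₁_arrival ht
  rw [eq_comm, ← sub_eq_iff_eq_add'.2 (S.add_ψ t).symm]
  linarith

theorem le_arrival (hD : S.RegularDelays) (ht : 0 ≤ t) : t ≤ S.arrival t :=
  (hD.φ₁_arrival ht).symm.trans_le
    (hD.φ₁_le (hD.delay₁.delayedTimeInv_nonneg (hD.φ₁_zero_le ht)))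

theorem arrival_nonneg (hD : S.RegularDelays) (ht : 0 ≤ t) : 0 ≤ S.arrival t :=
  ht.trans (hD.le_arrival ht)

theorem arrival_mono (hD : S.RegularDelays) (hs : 0 ≤ s) (hst : s ≤ t) :
    S.arrival s ≤ S.arrival t :=
  hD.delay₁.monotoneOn_delayedTimeInv (hD.φ₁_zero_le hs) (hD.φ₁_zero_le (hs.trans hst)) hst

theorem exists_ψ_mem_Icc (hD : S.RegularDelays) : ∃ r > 0, ∃ R, ∀ t ≥ 0, S.ψ t ∈ Icc r R := by
  obtain ⟨r, hr, hrD⟩ := hD.lower₁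
  obtain ⟨R, -, hRD⟩ := hD.delay₁.exists_forall_le
  refine ⟨r, hr, R, fun t ht => ?_⟩
  rw [hD.ψ_eq ht]
  exact ⟨hrD _ (hD.arrival_nonneg ht), hRD _ (hD.arrival_nonneg ht)⟩

theorem continuousOn_ψ (hD : S.RegularDelays) : ContinuousOn S.ψ (Ici 0) :=
  (hD.delay₁.continuousOn_delayedTimeInv.mono fun _ => hD.φ₁_zero_le).sub continuousOn_id

theorem mapsTo_φ₁ (hD : S.RegularDelays) (ht : 0 ≤ t) :
    MapsTo S.φ₁ (Icc t (S.arrival t)) (Icc (S.φ₁ t) t) := fun _ hs =>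
  ⟨hD.delay₁.monotoneOn ht (ht.trans hs.1) hs.1,
    (hD.delay₁.monotoneOn (ht.trans hs.1) (hD.arrival_nonneg ht) hs.2).trans_eq
      (hD.φ₁_arrival ht)⟩

end RegularDelays
end DelaySystem

/-! ### Closed-loop trajectories -/

namespace DelaySystem

open NormedSpace

variable {n m p : ℕ} {S : DelaySystem n m p} {ψh : ℝ → ℝ} {Z ξ : ℝ → Vec n} {U : ℝ → Vec m}
  {a b t : ℝ}

theorem flow_eq (r : ℝ) (x : Vec n) : S.flow r x = exp (r • mulCLM S.A) x := by
  rw [flow, mulE_eq_mulCLM, mulCLM_exp_smul]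

namespace IsClosedLoop

theorem exists_norm_input_le (h : S.IsClosedLoop ψh Z ξ U) {f : ℝ → ℝ} (hf : Continuous f)
    (a b : ℝ) : ∃ c, ∀ s ∈ uIcc a b, ‖U (f s)‖ ≤ c := by
  have hsub := (isCompact_uIcc.image hf).isBounded.subset_Icc_sInf_sSup (s := f '' uIcc a b)
  obtain ⟨c, hc⟩ := h.bdd_U (sInf (f '' uIcc a b)) (sSup (f '' uIcc a b))
  exact ⟨c, fun s hs => hc (mem_image_of_mem _ (hsub (mem_image_of_mem f hs)))⟩

theorem intervalIntegrable_input (h : S.IsClosedLoop ψh Z ξ U) {f : ℝ → ℝ} (hf : Continuous f)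
    (a b : ℝ) : IntervalIntegrable (fun s => U (f s)) volume a b := by
  obtain ⟨c, hc⟩ := h.exists_norm_input_le hf a b
  exact (intervalIntegrable_const (c := c)).mono_fun'
    (h.meas_U.comp hf.measurable).aestronglyMeasurable
    ((ae_restrict_iff' measurableSet_uIoc).2 (.of_forall fun s hs => hc s (uIoc_subset_uIcc hs)))

theorem intervalIntegrable_clm_input (h : S.IsClosedLoop ψh Z ξ U) {f : ℝ → ℝ}
    (hf : Continuous f) {d : ℕ} {Φ : ℝ → Vec m →L[ℝ] Vec d} (hΦ : Continuous Φ) (a b : ℝ) :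
    IntervalIntegrable (fun s => Φ s (U (f s))) volume a b :=
  intervalIntegrable_clm_apply hΦ.continuousOn (h.intervalIntegrable_input hf a b)

theorem continuousOn_state (h : S.IsClosedLoop ψh Z ξ U) (ha : S.φ₂ 0 ≤ a) (hab : a ≤ b) :
    ContinuousOn Z (uIcc a b) :=
  h.cont_Z.mono fun _ hs => ha.trans ((uIcc_of_le hab).subset hs).1

theorem intervalIntegrable_clm_state (h : S.IsClosedLoop ψh Z ξ U) (ha : S.φ₂ 0 ≤ a)
    (hab : a ≤ b) {d : ℕ} (T : Vec n →L[ℝ] Vec d) :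
    IntervalIntegrable (fun s => T (Z s)) volume a b :=
  (T.continuous.comp_continuousOn (h.continuousOn_state ha hab)).intervalIntegrable

theorem intervalIntegrable_plant (hD : S.RegularDelays) (h : S.IsClosedLoop ψh Z ξ U)
    (ha : S.φ₂ 0 ≤ a) (hab : a ≤ b) :
    IntervalIntegrable (fun s => mulE S.A (Z s) + mulE S.B (U (S.φ₁ s))) volume a b :=
  (h.intervalIntegrable_clm_state ha hab (mulCLM S.A)).add
    (h.intervalIntegrable_clm_input hD.continuous_φ₁
      (continuous_const (y := mulCLM S.B)) a b)

theorem state_eq_add_integral (hD : S.RegularDelays) (h : S.IsClosedLoop ψh Z ξ U)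
    (ha : S.φ₂ 0 ≤ a) (hab : a ≤ b) :
    Z b = Z a + ∫ s in a..b, (mulE S.A (Z s) + mulE S.B (U (S.φ₁ s))) := by
  rw [h.plant b (ha.trans hab), h.plant a ha, add_assoc,
    intervalIntegral.integral_add_adjacent_intervals (h.intervalIntegrable_plant hD le_rfl ha)
      (h.intervalIntegrable_plant hD ha hab)]

theorem state_eq_flow_add_integral (hD : S.RegularDelays) (h : S.IsClosedLoop ψh Z ξ U)
    (ha : S.φ₂ 0 ≤ a) (hab : a ≤ b) :
    Z b = S.flow (b - a) (Z a) + ∫ s in a..b, S.flow (b - s) (mulE S.B (U (S.φ₁ s))) := by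
  simp only [flow_eq]
  refine eq_exp_smul_add_integral_of_eq_integral (h.continuousOn_state ha hab)
    (h.intervalIntegrable_clm_input hD.continuous_φ₁ (continuous_const (y := mulCLM S.B)) a b) ?_
  exact fun s hs => h.state_eq_add_integral hD ha ((uIcc_of_le hab).subset hs).1

theorem state_sub_zHat (hD : S.RegularDelays) (h : S.IsClosedLoop ψh Z ξ U) (ht : 0 ≤ t) :
    Z t - S.zHat ξ U t = S.flow (t - S.φ₂ t) (Z (S.φ₂ t) - ξ t) := by
  have hφ₂ : S.φ₂ 0 ≤ S.φ₂ t := hD.delay₂.monotoneOn self_mem_Ici ht ht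
  rw [h.state_eq_flow_add_integral hD hφ₂ (hD.φ₂_le ht), zHat, add_sub_add_right_eq_sub]
  simp only [flow_eq, map_sub]

/-! ### Observer error -/

/-- In the time scale `r = φ₂(t)` the factor `φ₂'` disappears. -/
theorem observer_comp_delayedTimeInv (hD : S.RegularDelays) (h : S.IsClosedLoop ψh Z ξ U) {r : ℝ}
    (hr : S.φ₂ 0 ≤ r) :
    ξ (delayedTimeInv S.D₂ r) = ξ 0 + ∫ ρ in (S.φ₂ 0)..r,
      (mulE S.A (ξ (delayedTimeInv S.D₂ ρ)) + mulE S.B (U (S.φ₁ ρ)) +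
        mulE S.L (mulE S.C (Z ρ) - mulE S.C (ξ (delayedTimeInv S.D₂ ρ)))) := by
  have hinv := hD.delay₂.delayedTimeInv_nonneg hr
  have hcov := hD.delay₂.integral_deriv_smul_comp hD.differentiableOn_φ₂ (fun ρ =>
    mulE S.A (ξ (delayedTimeInv S.D₂ ρ)) + mulE S.B (U (S.φ₁ ρ)) +
      mulE S.L (mulE S.C (Z ρ) - mulE S.C (ξ (delayedTimeInv S.D₂ ρ)))) hinv
  rw [hD.delay₂.delayedTime_delayedTimeInv hr] at hcov
  refine (h.observer _ hinv).trans (congrArg (ξ 0 + ·) (Eq.trans ?_ hcov))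
  refine intervalIntegral.integral_congr fun s hs => ?_
  simp only [hD.delay₂.delayedTimeInv_delayedTime ((uIcc_of_le hinv).subset hs).1]
  rfl

theorem continuousOn_observer (hD : S.RegularDelays) (h : S.IsClosedLoop ψh Z ξ U)
    (hab : S.φ₂ 0 ≤ b) : ContinuousOn (ξ ∘ delayedTimeInv S.D₂) (uIcc (S.φ₂ 0) b) := by
  rw [uIcc_of_le hab]
  exact (h.cont_ξ.comp hD.delay₂.continuousOn_delayedTimeInv
    fun _ => hD.delay₂.delayedTimeInv_nonneg).mono Icc_subset_Ici_self

theorem state_sub_observer_eq_integral (hD : S.RegularDelays) (h : S.IsClosedLoop ψh Z ξ U)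
    {r : ℝ} (hr : S.φ₂ 0 ≤ r) :
    Z r - ξ (delayedTimeInv S.D₂ r) = (Z (S.φ₂ 0) - ξ 0) + ∫ ρ in (S.φ₂ 0)..r,
      mulCLM (S.A - S.L * S.C) (Z ρ - ξ (delayedTimeInv S.D₂ ρ)) := by
  have hZ (T : Vec n →L[ℝ] Vec n) := h.intervalIntegrable_clm_state le_rfl hr T
  have hξ (T : Vec n →L[ℝ] Vec n) : IntervalIntegrable
      (fun ρ => T (ξ (delayedTimeInv S.D₂ ρ))) volume (S.φ₂ 0) r :=
    (T.continuous.comp_continuousOn (h.continuousOn_observer hD hr)).intervalIntegrable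
  have hobserver : IntervalIntegrable (fun ρ =>
      mulE S.A (ξ (delayedTimeInv S.D₂ ρ)) + mulE S.B (U (S.φ₁ ρ)) +
        mulE S.L (mulE S.C (Z ρ) - mulE S.C (ξ (delayedTimeInv S.D₂ ρ)))) volume (S.φ₂ 0) r := by
    refine ((hξ (mulCLM S.A)).add (h.intervalIntegrable_clm_input hD.continuous_φ₁
      (continuous_const (y := mulCLM S.B)) _ _)).add ?_
    simpa only [mulE_eq_mulCLM, ← map_sub, mulCLM_mul_apply] using
      (hZ (mulCLM (S.L * S.C))).sub (hξ (mulCLM (S.L * S.C)))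
  rw [h.state_eq_add_integral hD le_rfl hr, h.observer_comp_delayedTimeInv hD hr,
    add_sub_add_comm, ← intervalIntegral.integral_sub (h.intervalIntegrable_plant hD le_rfl hr)
      hobserver]
  congr 1
  refine intervalIntegral.integral_congr fun ρ _ => ?_
  have hsub : mulCLM (S.A - S.L * S.C) = mulCLM S.A - mulCLM (S.L * S.C) := by simp [mulCLM]
  simp only [hsub, mulE_eq_mulCLM, sub_apply, mulCLM_mul_apply, map_sub]
  abel

theorem state_sub_observer_eq_exp (hD : S.RegularDelays) (h : S.IsClosedLoop ψh Z ξ U)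
    (ht : 0 ≤ t) :
    Z (S.φ₂ t) - ξ t =
      exp ((S.φ₂ t - S.φ₂ 0) • mulCLM (S.A - S.L * S.C)) (Z (S.φ₂ 0) - ξ 0) := by
  have hφ₂ : S.φ₂ 0 ≤ S.φ₂ t := hD.delay₂.monotoneOn self_mem_Ici ht ht
  have hinv {s : ℝ} (hs : 0 ≤ s) : delayedTimeInv S.D₂ (S.φ₂ s) = s :=
    hD.delay₂.delayedTimeInv_delayedTime hs
  have hvoc := eq_exp_smul_add_integral_of_eq_integral (T := mulCLM (S.A - S.L * S.C))
    (g := 0) ((h.continuousOn_state le_rfl hφ₂).sub (h.continuousOn_observer hD hφ₂))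
    intervalIntegrable_const fun r hr => by
      simpa [hinv le_rfl] using
        h.state_sub_observer_eq_integral hD ((uIcc_of_le hφ₂).subset hr).1
  simpa [hinv ht, hinv le_rfl] using hvoc

theorem initial_state_sub_observer (hD : S.RegularDelays) (h : S.IsClosedLoop ψh Z ξ U) :
    Z (S.φ₂ 0) - ξ 0 = exp (S.φ₂ 0 • mulCLM S.A) (Z 0 - S.zHat ξ U 0) := by
  rw [h.state_sub_zHat hD le_rfl, flow_eq, zero_sub, ← mul_apply_eq_comp,
    exp_smul_mul_exp_neg_smul (mulCLM S.A), one_apply_eq_self]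

/-- The bound `φ₂(t) - φ₂(0) ≥ t - sup D₂` turns decay in the time scale `φ₂` into decay in `t` at
the same rate. -/
theorem exists_reconstruction_decay (hD : S.RegularDelays) {μ : ℝ} (hμ : 0 ≤ μ)
    (hL : HasExpDecay (mulCLM (S.A - S.L * S.C)) μ) :
    ∃ c ≥ 0, ∀ {ψh Z ξ U}, S.IsClosedLoop ψh Z ξ U → ∀ t ≥ 0,
      ‖Z t - S.zHat ξ U t‖ ≤ c * ‖Z 0 - S.zHat ξ U 0‖ * Real.exp (-μ * t) := by
  obtain ⟨R, -, hR⟩ := hD.delay₂.exists_forall_le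
  obtain ⟨cA, hcA0, hcA⟩ := exists_norm_exp_smul_le (mulCLM S.A) R
  obtain ⟨cL, hcL0, hcL⟩ := hL
  set c₀ := ‖exp (S.φ₂ 0 • mulCLM S.A)‖
  refine ⟨cA * (cL * Real.exp (μ * R) * c₀), by positivity, fun {ψh Z ξ U} h t ht => ?_⟩
  have hlag : t - S.φ₂ t = S.D₂ t := sub_sub_cancel _ _
  have helapsed : t - R ≤ S.φ₂ t - S.φ₂ 0 := by
    linarith [hR t ht, hD.φ₂_le le_rfl]
  have hφ₂ : S.φ₂ 0 ≤ S.φ₂ t := hD.delay₂.monotoneOn self_mem_Ici ht ht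
  have hflow : ‖exp ((t - S.φ₂ t) • mulCLM S.A)‖ ≤ cA :=
    hcA _ (hlag ▸ ⟨hD.delay₂.nonneg t ht, hR t ht⟩)
  have hdecay : ‖exp ((S.φ₂ t - S.φ₂ 0) • mulCLM (S.A - S.L * S.C))‖ ≤
      cL * Real.exp (μ * R) * Real.exp (-μ * t) := by
    rw [mul_assoc, ← Real.exp_add]
    refine (hcL _ (sub_nonneg.2 hφ₂)).trans ?_
    gcongr
    nlinarith
  rw [h.state_sub_zHat hD ht, flow_eq, h.state_sub_observer_eq_exp hD ht,
    h.initial_state_sub_observer hD]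
  refine (ContinuousLinearMap.le_of_opNorm_le_of_le _ hflow
    (ContinuousLinearMap.le_of_opNorm_le_of_le _ hdecay
      (ContinuousLinearMap.le_opNorm _ _))).trans_eq ?_
  ring

end IsClosedLoop

end DelaySystem

/-! ### Predictor error -/

namespace DelaySystem

open NormedSpace

variable {n m p : ℕ} {S : DelaySystem n m p} {ψh : ℝ → ℝ} {Z ξ : ℝ → Vec n} {U : ℝ → Vec m}
  {a b c h k t N R : ℝ} {P : Vec n}

/-- `P` is a predictor that the closed loop may use at time `t` with the horizon `h`; the second
alternative is the causal case of the original-time form. -/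
def IsPredictor (S : DelaySystem n m p) (h : ℝ) (ξ : ℝ → Vec n) (U : ℝ → Vec m) (t : ℝ)
    (P : Vec n) : Prop :=
  P = S.predictorTransport h ξ U t ∨ h ≤ S.ψ t ∧ P = S.predictorDirect h ξ U t

theorem RegularDelays.norm_distInput_le (hD : S.RegularDelays) (ht : 0 ≤ t)
    (hU : ∀ τ ∈ Icc (S.φ₁ t) t, ‖U τ‖ ≤ N) {y : ℝ} (hy : y ∈ Icc (0 : ℝ) 1) :
    ‖S.distInput U y t‖ ≤ N := by
  have hψ : 0 ≤ S.ψ t := sub_nonneg.2 (hD.le_arrival ht)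
  refine hU _ (hD.mapsTo_φ₁ ht ⟨le_add_of_nonneg_right (mul_nonneg hy.1 hψ), ?_⟩)
  rw [← S.add_ψ]
  gcongr
  exact mul_le_of_le_one_left hψ hy.2

namespace IsClosedLoop

theorem exists_isPredictor (hloop : S.IsClosedLoop ψh Z ξ U) (ht : 0 < t) :
    ∃ P, S.IsPredictor (ψh t) ξ U t P ∧ U t = mulE S.K P :=
  (hloop.feedback t ht).elim (fun hU => ⟨_, .inl rfl, hU⟩) fun hU => ⟨_, .inr ⟨hU.1, rfl⟩, hU.2⟩

theorem norm_state_sub_le (hD : S.RegularDelays) (hloop : S.IsClosedLoop ψh Z ξ U)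
    (ha : S.φ₂ 0 ≤ a) (hab : a ≤ b) (hZ : ∀ s ∈ Icc a b, ‖Z s‖ ≤ N)
    (hU : ∀ s ∈ Icc a b, ‖U (S.φ₁ s)‖ ≤ N) :
    ‖Z b - Z a‖ ≤ (‖mulCLM S.A‖ + ‖mulCLM S.B‖) * N * (b - a) := by
  rw [hloop.state_eq_add_integral hD ha hab, add_sub_cancel_left,
    ← abs_of_nonneg (sub_nonneg.2 hab), add_mul]
  refine intervalIntegral.norm_integral_le_of_norm_le_const fun s hs => ?_
  rw [uIoc_of_le hab] at hs
  exact norm_add_le_of_le ((mulCLM S.A).le_opNorm_of_le (hZ s (Ioc_subset_Icc_self hs)))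
    ((mulCLM S.B).le_opNorm_of_le (hU s (Ioc_subset_Icc_self hs)))

theorem predictorDirect_sub (hD : S.RegularDelays) (hloop : S.IsClosedLoop ψh Z ξ U)
    (ht : 0 ≤ t) (hh : 0 ≤ h) :
    S.predictorDirect h ξ U t - Z (t + h) = S.flow h (S.zHat ξ U t - Z t) := by
  rw [hloop.state_eq_flow_add_integral hD (hD.φ₂_zero_le ht) (le_add_of_nonneg_right hh),
    predictorDirect, add_sub_add_right_eq_sub, add_sub_cancel_left]
  simp only [flow_eq, map_sub]

theorem norm_predictorDirect_sub_le (hD : S.RegularDelays) (hloop : S.IsClosedLoop ψh Z ξ U)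
    (hc : ∀ r ∈ Icc 0 R, ‖exp (r • mulCLM S.A)‖ ≤ c) (ht : 0 ≤ t) (hh : h ∈ Icc 0 R) :
    ‖S.predictorDirect h ξ U t - Z (t + h)‖ ≤ c * ‖Z t - S.zHat ξ U t‖ := by
  rw [hloop.predictorDirect_sub hD ht hh.1, flow_eq, norm_sub_rev (Z t)]
  exact ContinuousLinearMap.le_of_opNorm_le _ (hc h hh) _

theorem predictorTransport_sub (hD : S.RegularDelays) (hloop : S.IsClosedLoop ψh Z ξ U)
    (t h k : ℝ) :
    S.predictorTransport h ξ U t - S.predictorTransport k ξ U t =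
      (exp (h • mulCLM S.A) - exp (k • mulCLM S.A)) (S.zHat ξ U t) +
      ∫ y in (0 : ℝ)..1, (h • exp (((1 - y) * h) • mulCLM S.A) -
        k • exp (((1 - y) * k) • mulCLM S.A)) (mulE S.B (S.distInput U y t)) := by
  have hφ₁ : Continuous fun y : ℝ => S.φ₁ (t + y * S.ψ t) :=
    hD.continuous_φ₁.comp (by fun_prop)
  have hint (r : ℝ) : IntervalIntegrable (fun y => (r • exp (((1 - y) * r) • mulCLM S.A))
      (mulCLM S.B (S.distInput U y t))) volume 0 1 := by
    have hexp : Continuous fun y : ℝ => r • exp (((1 - y) * r) • mulCLM S.A) :=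
      ((continuous_exp_smul (mulCLM S.A)).comp (by fun_prop : Continuous fun y : ℝ =>
        (1 - y) * r)).const_smul r
    exact intervalIntegrable_clm_apply hexp.continuousOn
      (hloop.intervalIntegrable_clm_input hφ₁ continuous_const 0 1)
  simp only [sub_apply, mulE_eq_mulCLM]
  rw [intervalIntegral.integral_sub (hint h) (hint k), predictorTransport, predictorTransport]
  simp only [flow_eq, mulE_eq_mulCLM, smul_apply]
  abel

theorem norm_predictorTransport_sub_le (hD : S.RegularDelays) (hloop : S.IsClosedLoop ψh Z ξ U)
    (hc : ∀ r ∈ Icc 0 R, ‖exp (r • mulCLM S.A)‖ ≤ c) (hh : h ∈ Icc 0 R) (hk : k ∈ Icc 0 R)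
    (hN : ∀ y ∈ Icc (0 : ℝ) 1, ‖S.distInput U y t‖ ≤ N) :
    ‖S.predictorTransport h ξ U t - S.predictorTransport k ξ U t‖ ≤
      c * (‖mulCLM S.A‖ * ‖S.zHat ξ U t‖ + (1 + R * ‖mulCLM S.A‖) * ‖mulCLM S.B‖ * N) *
        |h - k| := by
  have hintegrand : ∀ y ∈ uIoc (0 : ℝ) 1, ‖(h • exp (((1 - y) * h) • mulCLM S.A) -
      k • exp (((1 - y) * k) • mulCLM S.A)) (mulE S.B (S.distInput U y t))‖ ≤
      c * (1 + R * ‖mulCLM S.A‖) * |h - k| * (‖mulCLM S.B‖ * N) := by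
    intro y hy
    rw [uIoc_of_le zero_le_one] at hy
    exact ContinuousLinearMap.le_of_opNorm_le_of_le _
      (norm_smul_exp_smul_sub_le hc ⟨by linarith [hy.2], by linarith [hy.1]⟩ hh hk)
      ((mulCLM S.B).le_opNorm_of_le (hN y (Ioc_subset_Icc_self hy)))
  rw [hloop.predictorTransport_sub hD]
  refine (norm_add_le_of_le
    (ContinuousLinearMap.le_of_opNorm_le _ (norm_exp_smul_sub_le hc hh hk) _)
    (intervalIntegral.norm_integral_le_of_norm_le_const hintegrand)).trans_eq ?_
  rw [sub_zero, abs_one]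
  ring

theorem norm_predictorTransport_sub_arrival_le (hD : S.RegularDelays)
    (hloop : S.IsClosedLoop ψh Z ξ U) (hc : ∀ r ∈ Icc 0 R, ‖exp (r • mulCLM S.A)‖ ≤ c)
    (ht : 0 ≤ t) (hh : h ∈ Icc 0 R) (hψ : S.ψ t ∈ Icc 0 R)
    (hZ : ‖Z t‖ ≤ N) (hU : ∀ τ ∈ Icc (S.φ₁ t) t, ‖U τ‖ ≤ N) :
    ‖S.predictorTransport h ξ U t - Z (S.arrival t)‖ ≤
      c * (‖mulCLM S.A‖ * (‖Z t - S.zHat ξ U t‖ + N) +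
        (1 + R * ‖mulCLM S.A‖) * ‖mulCLM S.B‖ * N) * |S.ψ t - h| +
        c * ‖Z t - S.zHat ξ U t‖ := by
  have hc0 : 0 ≤ c := (norm_nonneg _).trans (hc h hh)
  have hhorizon := hloop.norm_predictorTransport_sub_le hD hc hh hψ
    (fun y => hD.norm_distInput_le ht hU)
  have hexact := hloop.norm_predictorDirect_sub_le hD hc ht hψ
  have hzHat : ‖S.zHat ξ U t‖ ≤ ‖Z t - S.zHat ξ U t‖ + N := by
    linarith [norm_sub_norm_le (S.zHat ξ U t) (Z t), norm_sub_rev (Z t) (S.zHat ξ U t)]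
  rw [← predictorTransport_exact, add_ψ] at hexact
  rw [← sub_add_sub_cancel _ (S.predictorTransport (S.ψ t) ξ U t)]
  refine norm_add_le_of_le (hhorizon.trans ?_) hexact
  rw [abs_sub_comm]
  gcongr

theorem norm_predictorDirect_sub_arrival_le (hD : S.RegularDelays)
    (hloop : S.IsClosedLoop ψh Z ξ U) (hc : ∀ r ∈ Icc 0 R, ‖exp (r • mulCLM S.A)‖ ≤ c)
    (ht : 0 ≤ t) (hh : h ∈ Icc 0 R) (hψ : h ≤ S.ψ t)
    (hZ : ∀ s ∈ Icc t (S.arrival t), ‖Z s‖ ≤ N) (hU : ∀ τ ∈ Icc (S.φ₁ t) t, ‖U τ‖ ≤ N) :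
    ‖S.predictorDirect h ξ U t - Z (S.arrival t)‖ ≤
      c * ‖Z t - S.zHat ξ U t‖ + (‖mulCLM S.A‖ + ‖mulCLM S.B‖) * N * |S.ψ t - h| := by
  have hsub : Icc (t + h) (S.arrival t) ⊆ Icc t (S.arrival t) :=
    Icc_subset_Icc_left (le_add_of_nonneg_right hh.1)
  have hstate := hloop.norm_state_sub_le hD (hD.φ₂_zero_le (add_nonneg ht hh.1))
    (by rw [← S.add_ψ]; gcongr) (fun s hs => hZ s (hsub hs))
    fun s hs => hU _ (hD.mapsTo_φ₁ ht (hsub hs))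
  rw [← S.add_ψ, add_sub_add_left_eq_sub, ← abs_of_nonneg (sub_nonneg.2 hψ), S.add_ψ,
    norm_sub_rev] at hstate
  rw [← sub_add_sub_cancel _ (Z (t + h))]
  exact norm_add_le_of_le (hloop.norm_predictorDirect_sub_le hD hc ht hh) hstate

end IsClosedLoop

theorem RegularDelays.exists_norm_predictor_sub_le (hD : S.RegularDelays) :
    ∃ c ≥ 0, ∃ ε₀ > 0, ∀ {ψh Z ξ U}, S.IsClosedLoop ψh Z ξ U → ∀ {t h N P}, 0 ≤ t →
      |S.ψ t - h| ≤ ε₀ → (∀ s ∈ Icc t (S.arrival t), ‖Z s‖ ≤ N) →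
      (∀ τ ∈ Icc (S.φ₁ t) t, ‖U τ‖ ≤ N) → S.IsPredictor h ξ U t P →
        ‖P - Z (S.arrival t)‖ ≤ c * (‖Z t - S.zHat ξ U t‖ + |S.ψ t - h| * N) := by
  obtain ⟨r, hr, R, hψ⟩ := hD.exists_ψ_mem_Icc
  obtain ⟨c, hc0, hc⟩ := exists_norm_exp_smul_le (mulCLM S.A) (R + 1)
  have hR : 0 ≤ R := (hr.le.trans (hψ 0 le_rfl).1).trans (hψ 0 le_rfl).2
  set a := ‖mulCLM S.A‖
  set b := ‖mulCLM S.B‖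
  refine ⟨c + c * a + c * (1 + (R + 1) * a) * b + a + b, by positivity, min r 1,
    lt_min hr one_pos, fun {ψh Z ξ U} hloop t h N P ht hε hZ hU hP => ?_⟩
  obtain ⟨hψr, hψR⟩ := hψ t ht
  have hε1 : |S.ψ t - h| ≤ 1 := hε.trans (min_le_right _ _)
  have hh : h ∈ Icc 0 (R + 1) := by
    have hεr := abs_le.1 (hε.trans (min_le_left _ _))
    have hεone := abs_le.1 hε1
    constructor <;> linarith
  have hN : 0 ≤ N := (norm_nonneg _).trans (hZ t (left_mem_Icc.2 (hD.le_arrival ht)))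
  set e := ‖Z t - S.zHat ξ U t‖
  have : 0 ≤ e := norm_nonneg _
  rcases hP with rfl | ⟨hle, rfl⟩
  · have hbound := hloop.norm_predictorTransport_sub_arrival_le hD hc ht hh
      ⟨by linarith, by linarith⟩ (hZ t (left_mem_Icc.2 (hD.le_arrival ht))) hU
    have he1 : c * a * e * |S.ψ t - h| ≤ c * a * e := mul_le_of_le_one_right (by positivity) hε1
    have hspare : 0 ≤ (c * (1 + (R + 1) * a) * b + a + b) * e +
        (c + a + b) * (|S.ψ t - h| * N) := by positivity
    linarith
  · have hbound := hloop.norm_predictorDirect_sub_arrival_le hD hc ht hh hle hZ hU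
    have hspare : 0 ≤ (c * a + c * (1 + (R + 1) * a) * b + a + b) * e +
        (c + c * a + c * (1 + (R + 1) * a) * b) * (|S.ψ t - h| * N) := by positivity
    linarith

end DelaySystem

/-! ### Exponential envelopes -/

theorem exp_neg_mul_le_exp_neg_mul {s t μ : ℝ} (hμ : 0 ≤ μ) (h : s ≤ t) :
    Real.exp (-μ * t) ≤ Real.exp (-μ * s) := by
  rw [neg_mul, neg_mul]
  gcongr

theorem exp_neg_mul_le_of_sub_le {R s t μ : ℝ} (hμ : 0 ≤ μ) (h : t - R ≤ s) :
    Real.exp (-μ * s) ≤ Real.exp (μ * R) * Real.exp (-μ * t) := by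
  refine (exp_neg_mul_le_exp_neg_mul hμ h).trans_eq ?_
  rw [← Real.exp_add]
  ring_nf

namespace DelaySystem

variable {n m p : ℕ} {S : DelaySystem n m p} {ψh : ℝ → ℝ} {Z ξ : ℝ → Vec n} {U : ℝ → Vec m}
  {G N R T a b l s t δ μ τ : ℝ}

/-- The initial data of the trajectory, including the initial error of the reconstructed state,
have size at most `G`. -/
structure InitialDataLE (S : DelaySystem n m p) (G : ℝ) (Z ξ : ℝ → Vec n) (U : ℝ → Vec m) :
    Prop where
  state : ‖Z 0‖ ≤ G
  error : ‖Z 0 - S.zHat ξ U 0‖ ≤ G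
  input : ∀ τ ∈ Icc (S.φ₁ 0) 0, ‖U τ‖ ≤ G

/-- The inputs up to time `T`, and the states up to the arrival of the last of them, lie below
the exponential `N e^{-μt}`. -/
structure HasEnvelope (S : DelaySystem n m p) (μ N T : ℝ) (Z : ℝ → Vec n) (U : ℝ → Vec m) :
    Prop where
  state : ∀ s ∈ Icc 0 (S.arrival T), ‖Z s‖ ≤ N * Real.exp (-μ * s)
  input : ∀ τ ∈ Icc (S.φ₁ 0) T, ‖U τ‖ ≤ N * Real.exp (-μ * τ)

/-- Up to time `T` the input follows the exact predictor feedback `K Z(φ₁⁻¹(t))` with an error of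
at most `δ e^{-μt}`. -/
def Tracks (S : DelaySystem n m p) (μ δ T : ℝ) (Z : ℝ → Vec n) (U : ℝ → Vec m) : Prop :=
  ∀ t ∈ Ioc 0 T, ‖U t - mulE S.K (Z (S.arrival t))‖ ≤ δ * Real.exp (-μ * t)

theorem InitialDataLE.nonneg (h : S.InitialDataLE G Z ξ U) : 0 ≤ G :=
  (norm_nonneg _).trans h.state

theorem RegularDelays.exists_sub_le_φ₁ (hD : S.RegularDelays) :
    ∃ R ≥ 0, ∀ t ≥ 0, t - R ≤ S.φ₁ t := by
  obtain ⟨R, hR0, hR⟩ := hD.delay₁.exists_forall_le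
  exact ⟨R, hR0, fun t ht => sub_le_sub_left (hR t ht) t⟩

namespace HasEnvelope

theorem nonneg (hD : S.RegularDelays) (h : S.HasEnvelope μ N T Z U) (hT : 0 ≤ T) : 0 ≤ N :=
  nonneg_of_mul_nonneg_left ((norm_nonneg _).trans
    (h.input 0 ⟨hD.φ₁_le le_rfl, hT⟩)) (Real.exp_pos _)

theorem mono {N' : ℝ} (h : S.HasEnvelope μ N T Z U) (hN : N ≤ N') : S.HasEnvelope μ N' T Z U where
  state s hs := (h.state s hs).trans (by gcongr)
  input τ hτ := (h.input τ hτ).trans (by gcongr)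

theorem of_tendsto {u : ℕ → ℝ} (hu : Filter.Tendsto u Filter.atTop (nhds N))
    (h : ∀ k, S.HasEnvelope μ (u k) T Z U) : S.HasEnvelope μ N T Z U where
  state s hs := ge_of_tendsto' (hu.mul_const _) fun k => (h k).state s hs
  input τ hτ := ge_of_tendsto' (hu.mul_const _) fun k => (h k).input τ hτ

/-- The iterates of `N ↦ a + N / 2` converge to its fixed point `2a`. -/
theorem of_halving (h : S.HasEnvelope μ N T Z U)
    (hstep : ∀ N, S.HasEnvelope μ N T Z U → S.HasEnvelope μ (a + N / 2) T Z U) :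
    S.HasEnvelope μ (2 * a) T Z U := by
  have hiterate (k : ℕ) : S.HasEnvelope μ (2 * a + (1 / 2) ^ k * (N - 2 * a)) T Z U := by
    induction k with
    | zero => simpa using h
    | succ k ih =>
      convert hstep _ ih using 1
      ring
  refine of_tendsto ?_ hiterate
  simpa using ((tendsto_pow_atTop_nhds_zero_of_lt_one (r := (1 / 2 : ℝ)) (by norm_num)
    (by norm_num)).mul_const (N - 2 * a)).const_add (2 * a)

theorem norm_state_le (hD : S.RegularDelays) (h : S.HasEnvelope μ N T Z U) (hμ : 0 ≤ μ)
    (hR : 0 ≤ R) (ht : t ∈ Icc 0 T) (hs : s ∈ Icc t (S.arrival t)) :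
    ‖Z s‖ ≤ N * (Real.exp (μ * R) * Real.exp (-μ * t)) := by
  have hN := h.nonneg hD (ht.1.trans ht.2)
  refine (h.state s ⟨ht.1.trans hs.1, hs.2.trans (hD.arrival_mono ht.1 ht.2)⟩).trans ?_
  gcongr
  exact exp_neg_mul_le_of_sub_le hμ (by linarith [hs.1])

theorem norm_input_le (hD : S.RegularDelays) (h : S.HasEnvelope μ N T Z U) (hμ : 0 ≤ μ)
    (hR : ∀ t ≥ 0, t - R ≤ S.φ₁ t) (ht : t ∈ Icc 0 T) (hτ : τ ∈ Icc (S.φ₁ t) t) :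
    ‖U τ‖ ≤ N * (Real.exp (μ * R) * Real.exp (-μ * t)) := by
  have hN := h.nonneg hD (ht.1.trans ht.2)
  have hφ₁ : S.φ₁ 0 ≤ S.φ₁ t := hD.delay₁.monotoneOn self_mem_Ici ht.1 ht.1
  refine (h.input τ ⟨hφ₁.trans hτ.1, hτ.2.trans ht.2⟩).trans ?_
  gcongr
  exact exp_neg_mul_le_of_sub_le hμ ((hR t ht.1).trans hτ.1)

end HasEnvelope

theorem IsClosedLoop.exists_hasEnvelope (hD : S.RegularDelays) (hloop : S.IsClosedLoop ψh Z ξ U)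
    (hμ : 0 ≤ μ) (hT : 0 ≤ T) : ∃ N, S.HasEnvelope μ N T Z U := by
  obtain ⟨cZ, hcZ⟩ := isCompact_uIcc.exists_bound_of_continuousOn
    (hloop.continuousOn_state (hD.φ₂_zero_le le_rfl) (hD.arrival_nonneg hT))
  obtain ⟨cU, hcU⟩ := hloop.bdd_U (S.φ₁ 0) T
  have hc : 0 ≤ cZ := (norm_nonneg _).trans (hcZ 0 left_mem_uIcc)
  have hexp {c s : ℝ} (hc : 0 ≤ c) (hs : s ≤ S.arrival T) :
      c ≤ c * Real.exp (μ * S.arrival T) * Real.exp (-μ * s) := by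
    rw [mul_assoc]
    refine le_mul_of_one_le_right hc ?_
    simpa using exp_neg_mul_le_of_sub_le (t := s) (s := 0) hμ (sub_nonpos.2 hs)
  refine ⟨max cZ cU * Real.exp (μ * S.arrival T), fun s hs => ?_, fun τ hτ => ?_⟩
  · exact ((hcZ s (Icc_subset_uIcc hs)).trans (le_max_left _ _)).trans
      (hexp (hc.trans (le_max_left _ _)) hs.2)
  · exact ((hcU (mem_image_of_mem _ hτ)).trans (le_max_right _ _)).trans
      (hexp (hc.trans (le_max_left _ _)) (hτ.2.trans (hD.le_arrival hT)))

/-! ### Small gain -/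

theorem RegularDelays.exists_tracks (hD : S.RegularDelays) (hμ : 0 ≤ μ)
    (hL : HasExpDecay (mulCLM (S.A - S.L * S.C)) μ) :
    ∃ c ≥ 0, ∃ ε₀ > 0, ∀ {ψh Z ξ U}, S.IsClosedLoop ψh Z ξ U → ∀ {ε}, ε ≤ ε₀ →
      (∀ t ≥ 0, |S.ψ t - ψh t| ≤ ε) → ∀ {T G N}, S.InitialDataLE G Z ξ U →
      S.HasEnvelope μ N T Z U → S.Tracks μ (c * (G + ε * N)) T Z U := by
  obtain ⟨R, hR0, hR⟩ := hD.exists_sub_le_φ₁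
  obtain ⟨cO, hcO, hO⟩ := IsClosedLoop.exists_reconstruction_decay hD hμ hL
  obtain ⟨cP, hcP, ε₀, hε₀, hP⟩ := hD.exists_norm_predictor_sub_le
  set k := ‖mulCLM S.K‖
  refine ⟨k * cP * (cO + Real.exp (μ * R)), by positivity, ε₀, hε₀,
    fun {ψh Z ξ U} hloop {ε} hε hψ {T G N} hG hN t ht => ?_⟩
  have ht' : t ∈ Icc 0 T := Ioc_subset_Icc_self ht
  have hG0 := hG.nonneg
  have hN0 := hN.nonneg hD (ht'.1.trans ht'.2)
  obtain ⟨P, hPt, hU⟩ := hloop.exists_isPredictor ht.1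
  have hpredictor := hP hloop ht'.1 ((hψ t ht'.1).trans hε)
    (fun s => hN.norm_state_le hD hμ hR0 ht') (fun τ => hN.norm_input_le hD hμ hR ht') hPt
  have herror : ‖Z t - S.zHat ξ U t‖ ≤ cO * G * Real.exp (-μ * t) :=
    (hO hloop t ht'.1).trans (by gcongr; exact hG.error)
  have hε0 : 0 ≤ ε := (abs_nonneg _).trans (hψ t ht'.1)
  rw [hU, mulE_eq_mulCLM, mulE_eq_mulCLM, ← map_sub]
  calc ‖mulCLM S.K (P - Z (S.arrival t))‖
      ≤ k * (cP * (cO * G * Real.exp (-μ * t) +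
          ε * (N * (Real.exp (μ * R) * Real.exp (-μ * t))))) :=
        (mulCLM S.K).le_opNorm_of_le (hpredictor.trans (by gcongr; exact hψ t ht'.1))
    _ = k * cP * (cO * G + Real.exp (μ * R) * (ε * N)) * Real.exp (-μ * t) := by ring
    _ ≤ k * cP * ((cO + Real.exp (μ * R)) * G + (cO + Real.exp (μ * R)) * (ε * N)) *
          Real.exp (-μ * t) := by
        gcongr
        · exact le_add_of_nonneg_right (Real.exp_pos _).le
        · exact le_add_of_nonneg_left hcO
    _ = k * cP * (cO + Real.exp (μ * R)) * (G + ε * N) * Real.exp (-μ * t) := by ring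

theorem RegularDelays.exists_norm_state_le_initialData (hD : S.RegularDelays) :
    ∃ c ≥ 0, ∀ {ψh Z ξ U}, S.IsClosedLoop ψh Z ξ U → ∀ {G}, S.InitialDataLE G Z ξ U →
      ∀ s ∈ Icc 0 (S.arrival 0), ‖Z s‖ ≤ c * G := by
  have harr : 0 ≤ S.arrival 0 := hD.arrival_nonneg le_rfl
  obtain ⟨c, hc0, hc⟩ := exists_norm_exp_smul_le (mulCLM S.A) (S.arrival 0)
  refine ⟨c + c * ‖mulCLM S.B‖ * S.arrival 0, by positivity,
    fun {ψh Z ξ U} hloop {G} hG s hs => ?_⟩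
  have hG0 := hG.nonneg
  have hfree : ‖S.flow (s - 0) (Z 0)‖ ≤ c * G := by
    rw [flow_eq, sub_zero]
    exact ContinuousLinearMap.le_of_opNorm_le_of_le _ (hc s hs) hG.state
  have hforced : ‖∫ r in 0..s, S.flow (s - r) (mulE S.B (U (S.φ₁ r)))‖ ≤
      c * (‖mulCLM S.B‖ * G) * |s - 0| := by
    refine intervalIntegral.norm_integral_le_of_norm_le_const fun r hr => ?_
    rw [uIoc_of_le hs.1] at hr
    rw [flow_eq]
    exact ContinuousLinearMap.le_of_opNorm_le_of_le _
      (hc _ ⟨sub_nonneg.2 hr.2, (sub_le_self _ hr.1.le).trans hs.2⟩)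
      ((mulCLM S.B).le_opNorm_of_le
        (hG.input _ (hD.mapsTo_φ₁ le_rfl ⟨hr.1.le, hr.2.trans hs.2⟩)))
  rw [hloop.state_eq_flow_add_integral hD (hD.φ₂_zero_le le_rfl) hs.1]
  calc ‖S.flow (s - 0) (Z 0) + ∫ r in 0..s, S.flow (s - r) (mulE S.B (U (S.φ₁ r)))‖
      ≤ c * G + c * (‖mulCLM S.B‖ * G) * |s - 0| := norm_add_le_of_le hfree hforced
    _ ≤ c * G + c * (‖mulCLM S.B‖ * G) * S.arrival 0 := by
        rw [sub_zero, abs_of_nonneg hs.1]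
        gcongr
        exact hs.2
    _ = (c + c * ‖mulCLM S.B‖ * S.arrival 0) * G := by ring

theorem IsClosedLoop.state_eq_feedback_integral (hD : S.RegularDelays)
    (hloop : S.IsClosedLoop ψh Z ξ U) (ha : S.φ₂ 0 ≤ a) (hab : a ≤ b) :
    Z b = Z a + ∫ s in a..b, (mulCLM (S.A + S.B * S.K) (Z s) +
      mulCLM S.B (U (S.φ₁ s) - mulE S.K (Z s))) := by
  rw [hloop.state_eq_add_integral hD ha hab]
  congr 1
  refine intervalIntegral.integral_congr fun s _ => ?_
  have hadd : mulCLM (S.A + S.B * S.K) = mulCLM S.A + mulCLM (S.B * S.K) := by simp [mulCLM]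
  simp only [hadd, mulE_eq_mulCLM, add_apply, mulCLM_mul_apply, map_sub]
  abel

theorem Tracks.norm_feedback_error_le (hD : S.RegularDelays) (h : S.Tracks μ δ T Z U)
    (hμ : 0 ≤ μ) (hT : 0 ≤ T) (hδ : 0 ≤ δ) (hR : ∀ t ≥ 0, t - R ≤ S.φ₁ t)
    (hs : s ∈ Ioc (S.arrival 0) (S.arrival T)) :
    ‖U (S.φ₁ s) - mulE S.K (Z s)‖ ≤ δ * Real.exp (μ * R) * Real.exp (-μ * s) := by
  have harr : 0 ≤ S.arrival 0 := hD.arrival_nonneg le_rfl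
  have hs0 : 0 ≤ s := harr.trans hs.1.le
  have hpos : 0 < S.φ₁ s :=
    (hD.φ₁_arrival le_rfl).symm.trans_lt (hD.delay₁.strictMonoOn harr hs0 hs.1)
  have hle : S.φ₁ s ≤ T :=
    (hD.delay₁.monotoneOn hs0 (hD.arrival_nonneg hT) hs.2).trans_eq (hD.φ₁_arrival hT)
  have htrack := h (S.φ₁ s) ⟨hpos, hle⟩
  rw [hD.arrival_φ₁ hs0] at htrack
  rw [mul_assoc]
  refine htrack.trans ?_
  gcongr
  exact exp_neg_mul_le_of_sub_le hμ (hR s hs0)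

theorem RegularDelays.exists_norm_state_le_of_tracks (hD : S.RegularDelays) (hμ : 0 ≤ μ)
    (hμl : μ < l) (hK : HasExpDecay (mulCLM (S.A + S.B * S.K)) l) :
    ∃ c ≥ 0, ∀ {ψh Z ξ U}, S.IsClosedLoop ψh Z ξ U → ∀ {T δ}, 0 ≤ T → 0 ≤ δ →
      S.Tracks μ δ T Z U → ∀ s ∈ Icc (S.arrival 0) (S.arrival T),
        ‖Z s‖ ≤ c * (‖Z (S.arrival 0)‖ + δ) * Real.exp (-μ * s) := by
  obtain ⟨R, -, hR⟩ := hD.exists_sub_le_φ₁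
  obtain ⟨c, hc0, hc⟩ := hK
  have : 0 < l - μ := sub_pos.2 hμl
  set σ := S.arrival 0
  set b := ‖mulCLM S.B‖
  refine ⟨c * (Real.exp (μ * σ) + b * Real.exp (μ * R) / (l - μ)), by positivity,
    fun {ψh Z ξ U} hloop {T δ} hT hδ htrack s hs => ?_⟩
  have hσ : S.φ₂ 0 ≤ σ := hD.φ₂_zero_le (hD.arrival_nonneg le_rfl)
  have hinput : IntervalIntegrable (fun r => mulCLM S.B (U (S.φ₁ r) - mulE S.K (Z r)))
      volume σ s := by
    simp only [map_sub, mulE_eq_mulCLM, ← mulCLM_mul_apply]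
    exact (hloop.intervalIntegrable_clm_input hD.continuous_φ₁ continuous_const σ s).sub
      (hloop.intervalIntegrable_clm_state hσ hs.1 _)
  have hinput_le : ∀ r ∈ Ioc σ s, ‖mulCLM S.B (U (S.φ₁ r) - mulE S.K (Z r))‖ ≤
      b * (δ * Real.exp (μ * R)) * Real.exp (-μ * r) := by
    intro r hr
    rw [mul_assoc]
    exact (mulCLM S.B).le_opNorm_of_le
      (htrack.norm_feedback_error_le hD hμ hT hδ hR ⟨hr.1, hr.2.trans hs.2⟩)
  have hdecay := norm_le_exp_of_eq_integral hc0 hc hμl hs.1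
    ((hloop.continuousOn_state hσ hs.1).mono Icc_subset_uIcc) hinput (by positivity) hinput_le
    fun r hr => hloop.state_eq_feedback_integral hD hσ hr.1
  refine hdecay.trans ?_
  have hspare : 0 ≤ c * (Real.exp (μ * σ) * δ + b * Real.exp (μ * R) / (l - μ) * ‖Z σ‖) *
      Real.exp (-μ * s) := by positivity
  refine (le_add_of_nonneg_right hspare).trans_eq ?_
  ring

/-- The state stays in the envelope before the arrival of the first input `U(0⁺)` because of the
initial data, and afterwards because `A + BK` is stable. -/
theorem RegularDelays.exists_norm_state_le_exp (hD : S.RegularDelays) (hμ : 0 ≤ μ)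
    (hμl : μ < l) (hK : HasExpDecay (mulCLM (S.A + S.B * S.K)) l) :
    ∃ c ≥ 0, ∀ {ψh Z ξ U}, S.IsClosedLoop ψh Z ξ U → ∀ {T G δ}, 0 ≤ T → 0 ≤ δ →
      S.InitialDataLE G Z ξ U → S.Tracks μ δ T Z U → ∀ s ∈ Icc 0 (S.arrival T),
        ‖Z s‖ ≤ c * (G + δ) * Real.exp (-μ * s) := by
  obtain ⟨cI, hcI, hI⟩ := hD.exists_norm_state_le_initialData
  obtain ⟨cD, hcD, hdecay⟩ := hD.exists_norm_state_le_of_tracks hμ hμl hK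
  set σ := S.arrival 0
  refine ⟨cI * Real.exp (μ * σ) + cD * (cI + 1), by positivity,
    fun {ψh Z ξ U} hloop {T G δ} hT hδ hG htrack s hs => ?_⟩
  have hG0 := hG.nonneg
  rcases le_total s σ with hsσ | hsσ
  · calc ‖Z s‖ ≤ cI * G := hI hloop hG s ⟨hs.1, hsσ⟩
      _ ≤ cI * G * (Real.exp (μ * σ) * Real.exp (-μ * s)) :=
        le_mul_of_one_le_right (by positivity) (by
          simpa using exp_neg_mul_le_of_sub_le (s := 0) hμ (sub_nonpos.2 hsσ))
      _ = cI * Real.exp (μ * σ) * G * Real.exp (-μ * s) := by ring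
      _ ≤ (cI * Real.exp (μ * σ) + cD * (cI + 1)) * (G + δ) * Real.exp (-μ * s) := by
        gcongr
        · exact le_add_of_nonneg_right (by positivity)
        · exact le_add_of_nonneg_right hδ
  · calc ‖Z s‖ ≤ cD * (‖Z σ‖ + δ) * Real.exp (-μ * s) :=
        hdecay hloop hT hδ htrack s ⟨hsσ, hs.2⟩
      _ ≤ cD * ((cI + 1) * (G + δ)) * Real.exp (-μ * s) := by
        gcongr
        have hZσ := hI hloop hG σ (right_mem_Icc.2 (hD.arrival_nonneg le_rfl))
        have hspare : 0 ≤ G + cI * δ := by positivity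
        linarith
      _ ≤ (cI * Real.exp (μ * σ) + cD * (cI + 1)) * (G + δ) * Real.exp (-μ * s) := by
        rw [← mul_assoc]
        gcongr
        exact le_add_of_nonneg_left (by positivity)

theorem RegularDelays.exists_hasEnvelope_of_tracks (hD : S.RegularDelays) (hμ : 0 ≤ μ)
    (hμl : μ < l) (hK : HasExpDecay (mulCLM (S.A + S.B * S.K)) l) :
    ∃ c ≥ 0, ∀ {ψh Z ξ U}, S.IsClosedLoop ψh Z ξ U → ∀ {T G δ}, 0 ≤ T → 0 ≤ δ →
      S.InitialDataLE G Z ξ U → S.Tracks μ δ T Z U → S.HasEnvelope μ (c * (G + δ)) T Z U := by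
  obtain ⟨c, hc, hstate⟩ := hD.exists_norm_state_le_exp hμ hμl hK
  set k := ‖mulCLM S.K‖
  refine ⟨c + k * c + 1, by positivity, fun {ψh Z ξ U} hloop {T G δ} hT hδ hG htrack =>
    ⟨fun s hs => (hstate hloop hT hδ hG htrack s hs).trans ?_, fun τ hτ => ?_⟩⟩
  all_goals have hG0 := hG.nonneg
  · gcongr
    have : 0 ≤ k * c := by positivity
    linarith
  rcases le_or_gt τ 0 with hτ0 | hτ0
  · have hexp : 1 ≤ Real.exp (-μ * τ) :=
      Real.one_le_exp (mul_nonneg_of_nonpos_of_nonpos (neg_nonpos.2 hμ) hτ0)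
    calc ‖U τ‖ ≤ G := hG.input τ ⟨hτ.1, hτ0⟩
      _ ≤ 1 * (G + δ) * Real.exp (-μ * τ) := by
        rw [one_mul]
        exact (le_add_of_nonneg_right hδ).trans (le_mul_of_one_le_right (by positivity) hexp)
      _ ≤ (c + k * c + 1) * (G + δ) * Real.exp (-μ * τ) := by
        gcongr
        exact le_add_of_nonneg_left (by positivity)
  · have hle := hD.le_arrival hτ0.le
    have hZ := hstate hloop hT hδ hG htrack (S.arrival τ)
      ⟨hD.arrival_nonneg hτ0.le, hD.arrival_mono hτ0.le hτ.2⟩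
    have hKZ : ‖mulE S.K (Z (S.arrival τ))‖ ≤ k * (c * (G + δ) * Real.exp (-μ * τ)) := by
      rw [mulE_eq_mulCLM]
      exact (mulCLM S.K).le_opNorm_of_le (hZ.trans
        (mul_le_mul_of_nonneg_left (exp_neg_mul_le_exp_neg_mul hμ hle) (by positivity)))
    calc ‖U τ‖ ≤ ‖mulE S.K (Z (S.arrival τ))‖ + ‖U τ - mulE S.K (Z (S.arrival τ))‖ :=
          norm_le_norm_add_norm_sub' _ _
      _ ≤ k * (c * (G + δ) * Real.exp (-μ * τ)) + (G + δ) * Real.exp (-μ * τ) := by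
        refine add_le_add hKZ ((htrack τ ⟨hτ0, hτ.2⟩).trans ?_)
        gcongr
        exact le_add_of_nonneg_left hG0
      _ ≤ c * (G + δ) * Real.exp (-μ * τ) + (k * (c * (G + δ) * Real.exp (-μ * τ)) +
            (G + δ) * Real.exp (-μ * τ)) := le_add_of_nonneg_left (by positivity)
      _ = (c + k * c + 1) * (G + δ) * Real.exp (-μ * τ) := by ring

theorem RegularDelays.exists_hasEnvelope_halving (hD : S.RegularDelays) (hμ : 0 ≤ μ)
    (hμl : μ < l) (hK : HasExpDecay (mulCLM (S.A + S.B * S.K)) l)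
    (hL : HasExpDecay (mulCLM (S.A - S.L * S.C)) μ) :
    ∃ ε > 0, ∃ α, ∀ {ψh Z ξ U}, S.IsClosedLoop ψh Z ξ U →
      (∀ t ≥ 0, |S.ψ t - ψh t| ≤ ε) → ∀ {T G N}, 0 ≤ T → S.InitialDataLE G Z ξ U →
      S.HasEnvelope μ N T Z U → S.HasEnvelope μ (α * G + N / 2) T Z U := by
  obtain ⟨c, hc, ε₀, hε₀, htracks⟩ := hD.exists_tracks hμ hL
  obtain ⟨c', hc', henvelope⟩ := hD.exists_hasEnvelope_of_tracks hμ hμl hK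
  refine ⟨min ε₀ (1 / (2 * (c' * c + 1))), by positivity, c' * (1 + c),
    fun {ψh Z ξ U} hloop hψ {T G N} hT hG hN => ?_⟩
  set ε := min ε₀ (1 / (2 * (c' * c + 1)))
  have hG0 := hG.nonneg
  have hN0 := hN.nonneg hD hT
  have : 0 ≤ ε := by positivity
  have hgain : c' * c * ε ≤ 1 / 2 := by
    calc c' * c * ε ≤ (c' * c + 1) * (1 / (2 * (c' * c + 1))) := by
          gcongr
          · exact le_add_of_nonneg_right zero_le_one
          · exact min_le_right _ _
      _ = 1 / 2 := by field_simp
  refine (henvelope hloop hT (by positivity) hG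
    (htracks hloop (min_le_left _ _) hψ hG hN)).mono ?_
  calc c' * (G + c * (G + ε * N)) = c' * (1 + c) * G + c' * c * ε * N := by ring
    _ ≤ c' * (1 + c) * G + 1 / 2 * N := by gcongr
    _ = c' * (1 + c) * G + N / 2 := by ring

theorem RegularDelays.exists_hasEnvelope (hD : S.RegularDelays) (hμ : 0 ≤ μ)
    (hμl : μ < l) (hK : HasExpDecay (mulCLM (S.A + S.B * S.K)) l)
    (hL : HasExpDecay (mulCLM (S.A - S.L * S.C)) μ) :
    ∃ ε > 0, ∃ α, ∀ {ψh Z ξ U}, S.IsClosedLoop ψh Z ξ U →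
      (∀ t ≥ 0, |S.ψ t - ψh t| ≤ ε) → ∀ {T G}, 0 ≤ T → S.InitialDataLE G Z ξ U →
      S.HasEnvelope μ (α * G) T Z U := by
  obtain ⟨ε, hε, α, hhalving⟩ := hD.exists_hasEnvelope_halving hμ hμl hK hL
  refine ⟨ε, hε, 2 * α, fun {ψh Z ξ U} hloop hψ {T G} hT hG => ?_⟩
  obtain ⟨N, hN⟩ := hloop.exists_hasEnvelope hD hμ hT
  rw [mul_assoc]
  exact hN.of_halving fun N' => hhalving hloop hψ hT hG

/-! ### Stability constants -/

theorem sSup_sq_norm_nonneg (S : DelaySystem n m p) (U : ℝ → Vec m) (t : ℝ) :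
    0 ≤ sSup ((fun τ => ‖U τ‖ ^ 2) '' Icc (S.φ₁ t) t) :=
  Real.sSup_nonneg (forall_mem_image.2 fun _ _ => sq_nonneg _)

theorem Γ_nonneg (S : DelaySystem n m p) (Z ξ : ℝ → Vec n) (U : ℝ → Vec m) (t : ℝ) :
    0 ≤ S.Γ Z ξ U t :=
  add_nonneg (by positivity) (S.sSup_sq_norm_nonneg U t)

theorem RegularDelays.Γ_le (hD : S.RegularDelays) (ht : 0 ≤ t) {x y z : ℝ} (hx : ‖Z t‖ ≤ x)
    (hy : ‖Z t - S.zHat ξ U t‖ ≤ y) (hz : ∀ τ ∈ Icc (S.φ₁ t) t, ‖U τ‖ ≤ z) :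
    S.Γ Z ξ U t ≤ x ^ 2 + y ^ 2 + z ^ 2 := by
  have hsup : sSup ((fun τ => ‖U τ‖ ^ 2) '' Icc (S.φ₁ t) t) ≤ z ^ 2 :=
    csSup_le ((nonempty_Icc.2 (hD.φ₁_le ht)).image _)
      (forall_mem_image.2 fun τ hτ => pow_le_pow_left₀ (norm_nonneg _) (hz τ hτ) 2)
  unfold Γ
  gcongr

theorem IsClosedLoop.initialDataLE_sqrt_Γ {ψh : ℝ → ℝ} (hloop : S.IsClosedLoop ψh Z ξ U) :
    S.InitialDataLE √(S.Γ Z ξ U 0) Z ξ U := by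
  have hsup := S.sSup_sq_norm_nonneg U 0
  have hbdd : BddAbove ((fun τ => ‖U τ‖ ^ 2) '' Icc (S.φ₁ 0) 0) := by
    obtain ⟨c, hc⟩ := hloop.bdd_U (S.φ₁ 0) 0
    exact ⟨c ^ 2, forall_mem_image.2 fun τ hτ =>
      pow_le_pow_left₀ (norm_nonneg _) (hc (mem_image_of_mem _ hτ)) 2⟩
  refine ⟨Real.le_sqrt_of_sq_le ?_, Real.le_sqrt_of_sq_le ?_,
    fun τ hτ => Real.le_sqrt_of_sq_le ?_⟩
  · rw [Γ, add_assoc]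
    exact le_add_of_nonneg_right (by positivity)
  · rw [Γ, add_right_comm]
    exact le_add_of_nonneg_left (by positivity)
  · exact (le_csSup hbdd (mem_image_of_mem _ hτ)).trans (le_add_of_nonneg_left (by positivity))

theorem RegularDelays.exists_Γ_decay (hD : S.RegularDelays) (hμ : 0 ≤ μ)
    (hμl : μ < l) (hK : HasExpDecay (mulCLM (S.A + S.B * S.K)) l)
    (hL : HasExpDecay (mulCLM (S.A - S.L * S.C)) μ) :
    ∃ ε > 0, ∃ M > 0, ∀ {ψh Z ξ U}, S.IsClosedLoop ψh Z ξ U →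
      (∀ t ≥ 0, |S.ψ t - ψh t| ≤ ε) → ∀ t ≥ 0,
        S.Γ Z ξ U t ≤ M * Real.exp (-(2 * μ) * t) * S.Γ Z ξ U 0 := by
  obtain ⟨R, -, hR⟩ := hD.exists_sub_le_φ₁
  obtain ⟨cO, hcO, hO⟩ := IsClosedLoop.exists_reconstruction_decay hD hμ hL
  obtain ⟨ε, hε, α, henvelope⟩ := hD.exists_hasEnvelope hμ hμl hK hL
  refine ⟨ε, hε, α ^ 2 + cO ^ 2 + (α * Real.exp (μ * R)) ^ 2 + 1, by positivity,
    fun {ψh Z ξ U} hloop hψ t ht => ?_⟩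
  set G := √(S.Γ Z ξ U 0)
  set E := Real.exp (-μ * t)
  have hG : S.InitialDataLE G Z ξ U := hloop.initialDataLE_sqrt_Γ
  have hGsq : G ^ 2 = S.Γ Z ξ U 0 := Real.sq_sqrt (S.Γ_nonneg Z ξ U 0)
  have hEsq : E ^ 2 = Real.exp (-(2 * μ) * t) := by
    rw [← Real.exp_nat_mul]
    congr 1
    push_cast
    ring
  have hN := henvelope hloop hψ ht hG
  have herror : ‖Z t - S.zHat ξ U t‖ ≤ cO * G * E :=
    (hO hloop t ht).trans (by gcongr; exact hG.error)
  calc S.Γ Z ξ U t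
      ≤ (α * G * E) ^ 2 + (cO * G * E) ^ 2 + (α * G * (Real.exp (μ * R) * E)) ^ 2 :=
        hD.Γ_le ht (hN.state t ⟨ht, hD.le_arrival ht⟩) herror
          fun τ hτ => hN.norm_input_le hD hμ hR ⟨ht, le_rfl⟩ hτ
    _ = (α ^ 2 + cO ^ 2 + (α * Real.exp (μ * R)) ^ 2) * E ^ 2 * G ^ 2 := by ring
    _ ≤ (α ^ 2 + cO ^ 2 + (α * Real.exp (μ * R)) ^ 2 + 1) * E ^ 2 * G ^ 2 := by
        gcongr ?_ * _ * _
        exact le_add_of_nonneg_right zero_le_one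
    _ = (α ^ 2 + cO ^ 2 + (α * Real.exp (μ * R)) ^ 2 + 1) * Real.exp (-(2 * μ) * t) *
          S.Γ Z ξ U 0 := by rw [hEsq, hGsq]

/-- The decay rate `2μ` obtained from `exists_Γ_decay` does not depend on `ε`; it is lowered to
`2μ (1 - ε / (2 ε*))` to make it strictly decreasing in `ε`. -/
theorem RegularDelays.exists_isStabilityConstants (hD : S.RegularDelays)
    (hK : IsHurwitz (S.A + S.B * S.K)) (hL : IsHurwitz (S.A - S.L * S.C)) :
    ∃ (εs M : ℝ) (Cf : ℝ → ℝ),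
      S.IsStabilityConstants εs M Cf ∧ StrictAntiOn Cf (Ioc 0 εs) := by
  obtain ⟨lK, hlK, hdecayK⟩ := hK.exists_hasExpDecay
  obtain ⟨lL, hlL, hdecayL⟩ := hL.exists_hasExpDecay
  obtain ⟨μ, hμ, hμlt⟩ := exists_between (lt_min hlK hlL)
  obtain ⟨εs, hεs, M, hM, hΓ⟩ := hD.exists_Γ_decay hμ.le (hμlt.trans_le (min_le_left _ _)) hdecayK
    (hdecayL.mono (hμlt.le.trans (min_le_right _ _)))
  have hanti : StrictAnti fun ε => 2 * μ * (1 - ε / (2 * εs)) := fun x y hxy =>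
    mul_lt_mul_of_pos_left (sub_lt_sub_left (by gcongr) _) (by positivity)
  refine ⟨εs, M, fun ε => 2 * μ * (1 - ε / (2 * εs)), ⟨hεs, hM, fun ε hε => ?_,
    hanti.antitone.antitoneOn _, fun ε hε ψh hψ Z ξ U hloop t ht => ?_⟩, hanti.strictAntiOn _⟩
  · refine mul_pos (by positivity) (sub_pos.2 ?_)
    rw [div_lt_one (by positivity)]
    linarith [hε.2]
  · refine (hΓ hloop (fun t ht => (hψ t ht).trans hε.2.le) t ht).trans ?_
    have hΓ₀ := S.Γ_nonneg Z ξ U 0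
    have hratio : 0 ≤ ε / (2 * εs) := div_nonneg hε.1.le (by positivity)
    have hrate : 2 * μ * (1 - ε / (2 * εs)) ≤ 2 * μ :=
      mul_le_of_le_one_right (by positivity) (sub_le_self 1 hratio)
    gcongr

namespace IsStabilityConstants

variable {εs M ε H : ℝ} {Cf : ℝ → ℝ}

theorem sub_log_div_pos (h : S.IsStabilityConstants εs M Cf) (hε : ε ∈ Ioo 0 εs) (hH : 0 < H)
    (hlog : Real.log M / Cf εs < H) : 0 < Cf ε - Real.log M / H := by
  have hrate := h.rate_pos εs ⟨h.eps_pos, le_rfl⟩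
  have hanti : Cf εs ≤ Cf ε := h.rate_anti ⟨hε.1, hε.2.le⟩ ⟨h.eps_pos, le_rfl⟩ hε.2.le
  rw [sub_pos]
  exact ((div_lt_comm₀ hrate hH).1 hlog).trans_le hanti

theorem Γ_le_sub_log_div (h : S.IsStabilityConstants εs M Cf) (hε : ε ∈ Ioo 0 εs) {ψh : ℝ → ℝ}
    (hψ : ∀ t ≥ 0, |S.ψ t - ψh t| ≤ ε) (hloop : S.IsClosedLoop ψh Z ξ U) (hH : 0 < H)
    (ht : 0 ≤ t) :
    S.Γ Z ξ U t ≤ M * Real.exp (-(Cf ε - Real.log M / H) * t) * S.Γ Z ξ U 0 := by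
  have hbound := h.bound ε hε ψh hψ Z ξ U hloop
  have hM := h.M_pos
  have hΓ₀ := S.Γ_nonneg Z ξ U 0
  refine (hbound t ht).trans ?_
  rcases le_or_gt 1 M with hM1 | hM1
  · have hlog : 0 ≤ Real.log M / H := div_nonneg (Real.log_nonneg hM1) hH.le
    gcongr
    exact sub_le_self _ hlog
  · have hzero : S.Γ Z ξ U 0 ≤ M * S.Γ Z ξ U 0 := by simpa using hbound 0 le_rfl
    have : S.Γ Z ξ U 0 = 0 := by nlinarith
    simp [this]

end IsStabilityConstants

end DelaySystem

theorem mem_Icc_floor_window {H t : ℝ} (hH : 0 < H) (ht : 0 ≤ t) :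
    t ∈ Icc (⌊t / H⌋₊ * H) (⌊t / H⌋₊ * H + H) := by
  have hle : ⌊t / H⌋₊ * H ≤ t := (le_div_iff₀ hH).1 (Nat.floor_le (by positivity))
  have hlt : t < (⌊t / H⌋₊ + 1) * H := (div_lt_iff₀ hH).1 (Nat.lt_floor_add_one _)
  exact ⟨hle, by linarith⟩

theorem corollary1_general {n m p : ℕ} (S : DelaySystem n m p) (hD : S.RegularDelays)
    (hK : IsHurwitz (S.A + S.B * S.K)) (hL : IsHurwitz (S.A - S.L * S.C)) :
    (∃ (εs M : ℝ) (Cf : ℝ → ℝ),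
      S.IsStabilityConstants εs M Cf ∧ StrictAntiOn Cf (Set.Ioc 0 εs)) ∧
    ∀ (εs M : ℝ) (Cf : ℝ → ℝ), S.IsStabilityConstants εs M Cf →
      ∀ ε ∈ Set.Ioo 0 εs, ∀ H : ℝ, 0 < H →
        (∀ t ≥ 0, ∃ ψt : ℝ → ℝ, ContinuousOn ψt (Set.Icc t (t + H)) ∧
          ∀ τ ∈ Set.Icc t (t + H), |S.ψ τ - ψt τ| ≤ ε) ∧
        (Real.log M / Cf εs < H → 0 < Cf ε - Real.log M / H) ∧
        ∀ ψw : ℕ → ℝ → ℝ,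
          (∀ k : ℕ, ∀ τ ∈ Set.Icc (k * H) (k * H + H), |S.ψ τ - ψw k τ| ≤ ε) →
          ∀ (Z ξ : ℝ → Vec n) (U : ℝ → Vec m),
            S.IsClosedLoop (DelaySystem.windowed H ψw) Z ξ U →
            ∀ t ≥ 0, S.Γ Z ξ U t ≤
              M * Real.exp (-(Cf ε - Real.log M / H) * t) * S.Γ Z ξ U 0 := by
  refine ⟨hD.exists_isStabilityConstants hK hL, fun εs M Cf h ε hε H hH =>
    ⟨fun t ht => ⟨S.ψ, ?_, fun τ _ => ?_⟩, h.sub_log_div_pos hε hH, ?_⟩⟩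
  · exact hD.continuousOn_ψ.mono fun τ hτ => ht.trans hτ.1
  · rw [sub_self, abs_zero]
    exact hε.1.le
  · intro ψw hψw Z ξ U hloop t ht
    have hψ : ∀ τ ≥ 0, |S.ψ τ - DelaySystem.windowed H ψw τ| ≤ ε := fun τ hτ =>
      hψw _ τ (mem_Icc_floor_window hH hτ)
    exact h.Γ_le_sub_log_div hε hψ hloop hH ht

theorem corollary1 {n m p : ℕ} (S : DelaySystem n m p) (hS : S.Admissible) :
    (∃ (εs M : ℝ) (Cf : ℝ → ℝ),
      S.IsStabilityConstants εs M Cf ∧ StrictAntiOn Cf (Set.Ioc 0 εs)) ∧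
    ∀ (εs M : ℝ) (Cf : ℝ → ℝ), S.IsStabilityConstants εs M Cf →
      ∀ ε ∈ Set.Ioo 0 εs, ∀ H : ℝ, 0 < H → Real.log M / Cf εs < H →
        (∀ t ≥ 0, ∃ ψt : ℝ → ℝ, ContinuousOn ψt (Set.Icc t (t + H)) ∧
          ∀ τ ∈ Set.Icc t (t + H), |S.ψ τ - ψt τ| ≤ ε) ∧
        0 < Cf ε - Real.log M / H ∧
        ∀ ψw : ℕ → ℝ → ℝ,
          (∀ k : ℕ, ∀ τ ∈ Set.Icc (k * H) (k * H + H), |S.ψ τ - ψw k τ| ≤ ε) →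
          ∀ (Z ξ : ℝ → Vec n) (U : ℝ → Vec m),
            S.IsClosedLoop (DelaySystem.windowed H ψw) Z ξ U →
            ∀ t ≥ 0, S.Γ Z ξ U t ≤
              M * Real.exp (-(Cf ε - Real.log M / H) * t) * S.Γ Z ξ U 0 := by
  obtain ⟨hconst, hwindow⟩ := corollary1_general S hS.regularDelays hS.hurwitz_feedback
    hS.hurwitz_observer
  refine ⟨hconst, fun εs M Cf h ε hε H hH hlog => ?_⟩
  exact (hwindow εs M Cf h ε hε H hH).imp_right fun hrest => hrest.imp_left fun hpos => hpos hlog
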